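/- Let $\mathbb T^2=\mathbb R^2/\mathbb Z^2$ and let $\mathrm{Diff}^\infty(\mathbb T^2)$ be the set of all $C^\infty$ diffeomorphisms of $\mathbb T^2$ with the $C^\infty$ topology (uniform convergence of all derivatives). For $\theta\in\mathbb T^2$ let $R_\theta(x)=x+\theta$. Let $\overline{\mathcal O}$, the Anosov–Katok class, be the closure in $\mathrm{Diff}^\infty(\mathbb T^2)$ of $\{hR_\theta h^{-1} : h\in\mathrm{Diff}^\infty(\mathbb T^2),\ \theta\in\mathbb T^2\}$, and let $\overline{\mathcal O_\mu}$, the area-preserving Anosov–Katok class, be the closure of the set of those $hR_\theta h^{-1}$ for which $h$ preserves the Lebesgue measure. Both carry the subspace topology. Let $D=[0,1]^2$. For $f\in\overline{\mathcal O}$, a lift $\tilde f:\mathbb R^2\to\mathbb R^2$ of $f$ and a base point $\tilde x_0\in D$, a generalized rotation set of $f$ is a non-empty compact set $L\subset\mathbb R^2$ for which there is a sequence $(n_i)$ of natural numbers with $\operatorname{diam}(\tilde f^{n_i}(D))\to+\infty$ and $$\frac{\tilde f^{n_i}(D)-\tilde f^{n_i}(\tilde x_0)}{\operatorname{diam}(\tilde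 f^{n_i}(D))}\longrightarrow L$$ in the Hausdorff topology. Two non-empty compact sets $K,L\subset\mathbb R^2$ have the same homothety type if $L=rK+v$ for some $r>0$ and $v\in\mathbb R^2$. A set $K$ is point-symmetric if $2c-x\in K$ for some point $c\in\mathbb R^2$ and all $x\in K$. Theorem. For a generic $f\in\overline{\mathcal O}$, that is, for all $f$ in a countable intersection of open dense subsets of $\overline{\mathcal O}$, the following holds: for every point-symmetric compact convex set $K\subset\mathbb R^2$ with more than one point (and for every choice of the lift $\tilde f$ and of the base point $\tilde x_0\in D$), $f$ has a generalized rotation set of the same homothety type as $K$. The same is true for a generic $f\in\overline{\mathcal O_\mu}$. -/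

import Mathlib

open Filter Topology MeasureTheory
open scoped ContDiff

noncomputable section

/-- The Euclidean plane. -/
abbrev Plane : Type := EuclideanSpace ℝ (Fin 2)

/-- The torus `𝕋² = (ℝ/ℤ)²`. -/
abbrev Torus : Type := UnitAddTorus (Fin 2)

/-- The universal covering projection `ℝ² → 𝕋²`. -/
def torusProj (x : Plane) : Torus := fun i => (x i : UnitAddCircle)

/-- `F : ℝ² → ℝ²` is a (continuous) lift of the torus map `f`. -/
def IsLift (F : Plane → Plane) (f : Torus → Torus) : Prop :=
  Continuous F ∧ ∀ x, torusProj (F x) = f (torusProj x)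

/-- A map of the torus is smooth iff it has a smooth lift to the plane
(every continuous map of the torus has a lift, and the covering projection is a local
diffeomorphism). -/
def IsSmoothTorusMap (f : Torus → Torus) : Prop :=
  ∃ F : Plane → Plane, IsLift F f ∧ ContDiff ℝ ∞ F

/-- `Diff^∞(𝕋²)`: the smooth diffeomorphisms of the torus (of any homotopy class). -/
structure TorusDiffeo extends Equiv Torus Torus where
  smooth_toFun : IsSmoothTorusMap toFun
  smooth_invFun : IsSmoothTorusMap invFun

namespace TorusDiffeo

instance : CoeFun TorusDiffeo (fun _ => Torus → Torus) := ⟨fun f => f.toFun⟩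

/-- `g` is `ε`-close to `f` in the `C^k` sense: for suitable lifts, all derivatives of order at
most `k` differ by less than `ε`, uniformly on the plane. -/
def CkClose (k : ℕ) (ε : ℝ) (f g : TorusDiffeo) : Prop :=
  ∃ F G : Plane → Plane, IsLift F f ∧ IsLift G g ∧
    ∀ j ≤ k, ∀ x, ‖iteratedFDeriv ℝ j F x - iteratedFDeriv ℝ j G x‖ < ε

theorem CkClose.mono {k l : ℕ} {ε δ : ℝ} {f g : TorusDiffeo} (hkl : k ≤ l) (hδ : δ ≤ ε)
    (h : CkClose l δ f g) : CkClose k ε f g := by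
  obtain ⟨F, G, hF, hG, hFG⟩ := h
  exact ⟨F, G, hF, hG, fun j hj x => (hFG j (hj.trans hkl) x).trans_le hδ⟩

/-- The `C^∞` topology: uniform convergence of all derivatives. -/
instance : TopologicalSpace TorusDiffeo where
  IsOpen U := ∀ f ∈ U, ∃ k : ℕ, ∃ ε : ℝ, 0 < ε ∧ ∀ g, CkClose k ε f g → g ∈ U
  isOpen_univ := fun _ _ => ⟨0, 1, one_pos, fun _ _ => trivial⟩
  isOpen_inter := by
    rintro U V hU hV f ⟨hfU, hfV⟩
    obtain ⟨k, ε, hε, h⟩ := hU f hfU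
    obtain ⟨l, δ, hδ, h'⟩ := hV f hfV
    exact ⟨max k l, min ε δ, lt_min hε hδ, fun g hg =>
      ⟨h g (hg.mono (le_max_left _ _) (min_le_left _ _)),
        h' g (hg.mono (le_max_right _ _) (min_le_right _ _))⟩⟩
  isOpen_sUnion := by
    rintro S hS f ⟨U, hU, hf⟩
    obtain ⟨k, ε, hε, h⟩ := hS U hU f hf
    exact ⟨k, ε, hε, fun g hg => ⟨U, hU, h g hg⟩⟩

end TorusDiffeo

/-- The diffeomorphisms `h ∘ R_θ ∘ h⁻¹`, where `h ∈ H` and `R_θ x = x + θ` is a rotation. -/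
def conjugatesOfRotations (H : Set TorusDiffeo) : Set TorusDiffeo :=
  {f | ∃ h ∈ H, ∃ θ : Torus, ∀ x, f x = h (h.invFun x + θ)}

/-- The Anosov–Katok class of the torus: the `C^∞` closure, among diffeomorphisms, of the
set of smooth conjugates of rotations. -/
def anosovKatokClass : Set TorusDiffeo :=
  closure (conjugatesOfRotations Set.univ)

/-- The area-preserving Anosov–Katok class: the conjugating diffeomorphisms are required to
preserve the Lebesgue measure. -/
def areaPreservingAnosovKatokClass : Set TorusDiffeo :=
  closure (conjugatesOfRotations {h | MeasurePreserving h volume volume})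

/-- The closed unit square `D = [0,1]²`. -/
def unitSquare : Set Plane := {x | ∀ i, x i ∈ Set.Icc (0 : ℝ) 1}

/-- `L` is a generalized rotation set of the lift `F` with base point `x₀`: a non-empty compact
set that is the Hausdorff limit of `(F^{n_i}(D) - F^{n_i}(x₀)) / diam (F^{n_i}(D))`, for some
sequence of natural numbers `n_i` such that `diam (F^{n_i}(D)) → ∞`. -/
def IsGeneralizedRotationSet (F : Plane → Plane) (x₀ : Plane) (L : Set Plane) : Prop :=
  IsCompact L ∧ L.Nonempty ∧ ∃ n : ℕ → ℕ,
    Tendsto (fun i => Metric.diam (F^[n i] '' unitSquare)) atTop atTop ∧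
    Tendsto (fun i => Metric.hausdorffEDist
      ((fun y => (Metric.diam (F^[n i] '' unitSquare))⁻¹ • (F^[n i] y - F^[n i] x₀)) ''
        unitSquare) L) atTop (𝓝 0)

/-- Two sets have the same homothety type: one is the image of the other under a composition
of a homothety of positive ratio and a translation. -/
def SameHomothetyType (K L : Set Plane) : Prop :=
  ∃ r : ℝ, 0 < r ∧ ∃ v : Plane, L = (fun x => r • x + v) '' K

/-- `K` is symmetric about some point of the plane. -/
def IsPointSymmetric (K : Set Plane) : Prop :=
  ∃ c : Plane, ∀ x ∈ K, (2 : ℝ) • c - x ∈ K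

/-- For every choice of a base point in `D` and of a lift, `f` has generalized rotation sets of
the homothety types of all point-symmetric compact convex sets with more than one point
(a generalized rotation set has diameter `1`, so it is never a single point). -/
def AdmitsAllSymmetricTypes (f : TorusDiffeo) : Prop :=
  ∀ x₀ ∈ unitSquare, ∀ F : Plane → Plane, IsLift F f →
    ∀ K : Set Plane, IsCompact K → Convex ℝ K → K.Nontrivial → IsPointSymmetric K →
      ∃ L : Set Plane, IsGeneralizedRotationSet F x₀ L ∧ SameHomothetyType K L

end

/-! Being nearly homothetic to `K` after some iterate is an open condition (`isOpen_shapeSet`). The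
main point is that it is also dense. Start from `h R_θ h⁻¹` and move `θ` to a rational `β₀ = p/q`.
If `φ` preserves area and commutes with the translations by `q⁻¹ℤ²`, replacing `h` by `hφ` does not
change the conjugate of `R_{β₀}`. With `φ` fixed, take `β = β₀ + t/(qn)` with `n` large and `t = (0,
√2)`. The new conjugate is close to the old one, while its iterate of order `qn` is the conjugate of
`R_t`, however wild `φ` is (`exists_conjRotation_mem_shapeSet`).

It remains to choose `φ` so that `Φ (x + t) - Φ x - t` fills out a prescribed large shape. `Φ` is a
composition of shears in integer directions `N i`, each oscillating much faster than the earlier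
ones. Each shear contributes between `-1` and `1` times `N i`, and because of the oscillation every
pattern of signs occurs on some open set (`exists_torusDiffeo_displacement`). The displacements thus
lie in the zonotope of the `N i` and include all its signed sums. Planar symmetric convex sets are
limits of zonotopes (`exists_zonotope`), and splitting the generators makes the signed sums a net
(`exists_zonotope_signs`). A lift of `h` is at bounded distance from an invertible linear map `A`,
so the `N i` are chosen near large multiples of generators for the preimage of the centred `K` under
`A`. All additive errors become negligible at large scale.

A countable Hausdorff-dense family of shapes then gives a residual set, and compactness extracts the
rotation sets (`exists_isGeneralizedRotationSet`). -/

noncomputable section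

/-! ### The integer lattice and the covering projection -/

/-- The vector of the plane with integer coordinates `k`. -/
def intVec (k : Fin 2 → ℤ) : Plane := WithLp.toLp 2 fun i => (k i : ℝ)

@[simp] theorem intVec_apply (k : Fin 2 → ℤ) (i : Fin 2) : intVec k i = k i := rfl

theorem intVec_add (k l : Fin 2 → ℤ) : intVec (k + l) = intVec k + intVec l := by
  ext i; simp

theorem intVec_neg (k : Fin 2 → ℤ) : intVec (-k) = -intVec k := by
  ext i; simp

@[simp] theorem intVec_zero : intVec 0 = 0 := by
  ext i; simp

theorem intVec_zsmul (n : ℤ) (k : Fin 2 → ℤ) : intVec (n • k) = (n : ℝ) • intVec k := by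
  ext i; simp

theorem intVec_sum {ι : Type*} (s : Finset ι) (k : ι → Fin 2 → ℤ) :
    intVec (∑ i ∈ s, k i) = ∑ i ∈ s, intVec (k i) := by
  classical
  induction s using Finset.induction_on with
  | empty => simp
  | insert a s ha ih => rw [Finset.sum_insert ha, Finset.sum_insert ha, intVec_add, ih]

@[simp] theorem torusProj_apply (x : Plane) (i : Fin 2) : torusProj x i = (x i : UnitAddCircle) :=
  rfl

theorem torusProj_add (x y : Plane) : torusProj (x + y) = torusProj x + torusProj y := by
  funext i; simp

theorem torusProj_sub (x y : Plane) : torusProj (x - y) = torusProj x - torusProj y := by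
  funext i; simp

@[simp] theorem torusProj_intVec (k : Fin 2 → ℤ) : torusProj (intVec k) = 0 := by
  funext i
  rw [torusProj_apply, Pi.zero_apply, AddCircle.coe_eq_zero_iff]
  exact ⟨k i, by simp⟩

@[simp] theorem torusProj_add_intVec (x : Plane) (k : Fin 2 → ℤ) :
    torusProj (x + intVec k) = torusProj x := by
  rw [torusProj_add, torusProj_intVec, add_zero]

theorem torusProj_eq_zero_iff {x : Plane} : torusProj x = 0 ↔ ∃ k, x = intVec k := by
  constructor
  · intro h
    have h' : ∀ i, ∃ n : ℤ, (n : ℝ) = x i := by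
      intro i
      have := congrFun h i
      rw [torusProj_apply, Pi.zero_apply, AddCircle.coe_eq_zero_iff] at this
      obtain ⟨n, hn⟩ := this
      exact ⟨n, by simpa using hn⟩
    choose n hn using h'
    exact ⟨n, by ext i; simp [hn]⟩
  · rintro ⟨k, rfl⟩
    simp

theorem torusProj_eq_iff {x y : Plane} : torusProj x = torusProj y ↔ ∃ k, x = y + intVec k := by
  rw [← sub_eq_zero, ← torusProj_sub, torusProj_eq_zero_iff]
  simp only [sub_eq_iff_eq_add']

theorem torusProj_surjective : Function.Surjective torusProj := by
  intro z
  choose x hx using fun i => QuotientAddGroup.mk_surjective (z i)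
  exact ⟨WithLp.toLp 2 x, funext hx⟩

theorem exists_unitSquare_add_intVec (x : Plane) : ∃ y ∈ unitSquare, ∃ k, x = y + intVec k := by
  refine ⟨WithLp.toLp 2 fun i => Int.fract (x i), fun i =>
    ⟨Int.fract_nonneg _, (Int.fract_lt_one _).le⟩, fun i => ⌊x i⌋, ?_⟩
  ext i
  simp

theorem exists_unitSquare_torusProj (z : Torus) : ∃ y ∈ unitSquare, torusProj y = z := by
  obtain ⟨x, rfl⟩ := torusProj_surjective z
  obtain ⟨y, hy, k, rfl⟩ := exists_unitSquare_add_intVec x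
  exact ⟨y, hy, by simp⟩

theorem isCompact_unitSquare : IsCompact unitSquare := by
  have h : unitSquare = (PiLp.continuousLinearEquiv 2 ℝ fun _ : Fin 2 => ℝ).toHomeomorph ⁻¹'
      (Set.univ.pi fun _ => Set.Icc (0 : ℝ) 1) := by
    ext x
    simp only [unitSquare, Set.mem_ofPred_eq, Set.mem_preimage, Set.mem_univ_pi]
    rfl
  rw [h, Homeomorph.isCompact_preimage]
  exact isCompact_univ_pi fun _ => isCompact_Icc

/-! ### Lifts -/

namespace IsLift

variable {F G : Plane → Plane} {f g : Torus → Torus}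

theorem comp (hF : IsLift F f) (hG : IsLift G g) : IsLift (F ∘ G) (f ∘ g) :=
  ⟨hF.1.comp hG.1, fun x => by simp [hF.2, hG.2]⟩

theorem iterate (hF : IsLift F f) (n : ℕ) : IsLift F^[n] f^[n] := by
  induction n with
  | zero => exact ⟨continuous_id, fun _ => rfl⟩
  | succ n ih =>
    rw [Function.iterate_succ, Function.iterate_succ]
    exact ih.comp hF

theorem add_intVec (hF : IsLift F f) (k : Fin 2 → ℤ) : IsLift (fun x => F x + intVec k) f :=
  ⟨hF.1.add continuous_const, fun x => by simp [hF.2]⟩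

theorem comp_add_intVec (hF : IsLift F f) (k : Fin 2 → ℤ) : IsLift (fun x => F (x + intVec k)) f :=
  ⟨hF.1.comp (by fun_prop), fun x => by simp [hF.2]⟩

/-- Two lifts of a torus map differ by an integer vector. -/
theorem eq_add_intVec (hF : IsLift F f) (hG : IsLift G f) : ∃ k, ∀ x, F x = G x + intVec k := by
  have h : ∀ x, ∃ k, F x = G x + intVec k := fun x =>
    torusProj_eq_iff.1 ((hF.2 x).trans (hG.2 x).symm)
  choose k hk using h
  have hc : ∀ i, Continuous fun x => k x i := by
    intro i
    rw [Int.isClosedEmbedding_coe_real.isInducing.continuous_iff]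
    have : (Int.cast ∘ fun x => k x i : Plane → ℝ) = fun x => F x i - G x i := by
      funext x
      have := congrArg (fun y : Plane => y i) (hk x)
      simp only [PiLp.add_apply, intVec_apply] at this
      simp [this]
    rw [this]
    have := hF.1
    have := hG.1
    fun_prop
  refine ⟨k 0, fun x => ?_⟩
  rw [hk x]
  congr 2
  funext i
  exact PreconnectedSpace.constant inferInstance (hc i)

/-- A lift maps translations by integer vectors to translations by integer vectors. -/
theorem translate (hF : IsLift F f) (k : Fin 2 → ℤ) :
    ∃ l, ∀ x, F (x + intVec k) = F x + intVec l :=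
  (hF.comp_add_intVec k).eq_add_intVec hF

theorem contDiff (hF : IsLift F f) (hf : IsSmoothTorusMap f) : ContDiff ℝ ∞ F := by
  obtain ⟨G, hG, hG'⟩ := hf
  obtain ⟨k, hk⟩ := hF.eq_add_intVec hG
  rw [funext hk]
  exact hG'.add contDiff_const

end IsLift

/-- Every lift of a diffeomorphism of the torus is a diffeomorphism of the plane. -/
theorem TorusDiffeo.exists_inverse_lift {h : TorusDiffeo} {H : Plane → Plane} (hH : IsLift H h) :
    ∃ H' : Plane → Plane, IsLift H' h.invFun ∧ ContDiff ℝ ∞ H' ∧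
      (∀ x, H (H' x) = x) ∧ ∀ x, H' (H x) = x := by
  obtain ⟨G, hG, hGs⟩ := h.smooth_invFun
  have hid : IsLift id (id : Torus → Torus) := ⟨continuous_id, fun _ => rfl⟩
  have h1 : h.toFun ∘ h.invFun = id := funext h.right_inv
  have h2 : h.invFun ∘ h.toFun = id := funext h.left_inv
  obtain ⟨k, hk⟩ := (h1 ▸ hH.comp hG).eq_add_intVec hid
  have hG' := hG.comp_add_intVec (-k)
  have hr : ∀ x, H (G (x + intVec (-k))) = x := by
    intro x
    have := hk (x + intVec (-k))
    simpa [intVec_neg] using this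
  obtain ⟨l, hl⟩ := (h2 ▸ hG'.comp hH).eq_add_intVec hid
  have hl' : ∀ x, G (H x + intVec (-k)) = x + intVec l := hl
  refine ⟨_, hG', hGs.comp (contDiff_id.add contDiff_const), hr, fun x => ?_⟩
  -- The other composition is a translation by a constant `l`. Then `H` is `l`-periodic, which
  -- forces `l = 0`.
  have h3 : H (x + intVec l) = H x := by rw [← hl' x, hr]
  have h4 := hl' (x + intVec l)
  rw [h3, hl' x] at h4
  rw [hl' x]
  simpa using h4.symm

/-- Composition of torus diffeomorphisms. -/
def TorusDiffeo.comp (g f : TorusDiffeo) : TorusDiffeo where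
  toEquiv := f.toEquiv.trans g.toEquiv
  smooth_toFun := by
    obtain ⟨F, hF, hF'⟩ := f.smooth_toFun
    obtain ⟨G, hG, hG'⟩ := g.smooth_toFun
    exact ⟨G ∘ F, hG.comp hF, hG'.comp hF'⟩
  smooth_invFun := by
    obtain ⟨F, hF, hF'⟩ := f.smooth_invFun
    obtain ⟨G, hG, hG'⟩ := g.smooth_invFun
    exact ⟨F ∘ G, hF.comp hG, hF'.comp hG'⟩

/-- Inverse of a torus diffeomorphism. -/
def TorusDiffeo.inv (f : TorusDiffeo) : TorusDiffeo where
  toEquiv := f.toEquiv.symm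
  smooth_toFun := f.smooth_invFun
  smooth_invFun := f.smooth_toFun

/-- The rotation `x ↦ x + θ`. -/
def TorusDiffeo.rotation (θ : Plane) : TorusDiffeo where
  toEquiv := Equiv.addRight (torusProj θ)
  smooth_toFun := ⟨fun x => x + θ, ⟨by fun_prop, fun x => torusProj_add x θ⟩, by fun_prop⟩
  smooth_invFun := ⟨fun x => x - θ, ⟨by fun_prop, fun x => by
    rw [torusProj_sub, sub_eq_add_neg]; rfl⟩, by fun_prop⟩

/-- The conjugate `h ∘ R_θ ∘ h⁻¹` of a rotation. -/
def TorusDiffeo.conjRotation (h : TorusDiffeo) (θ : Plane) : TorusDiffeo :=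
  h.comp ((TorusDiffeo.rotation θ).comp h.inv)

theorem TorusDiffeo.conjRotation_apply (h : TorusDiffeo) (θ : Plane) (x : Torus) :
    h.conjRotation θ x = h (h.invFun x + torusProj θ) := rfl

theorem TorusDiffeo.conjRotation_iterate (h : TorusDiffeo) (θ : Plane) (n : ℕ) (x : Torus) :
    (h.conjRotation θ)^[n] x = h (h.invFun x + n • torusProj θ) := by
  induction n with
  | zero => simp
  | succ n ih =>
    rw [Function.iterate_succ_apply', ih, h.conjRotation_apply]
    have : h.invFun (h (h.invFun x + n • torusProj θ)) = _ := h.left_inv _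
    rw [this, succ_nsmul, add_assoc]

/-! ### The linear part of a lift -/

/-- The integer increments of a lift are additive in `k`, so their values on the standard basis
extend linearly. The conjugating diffeomorphism may have any homotopy class, so `A` need not be the
identity. -/
theorem IsLift.exists_linear {F : Plane → Plane} {f : Torus → Torus} (hF : IsLift F f) :
    ∃ A : Plane →L[ℝ] Plane, ∀ k x, F (x + intVec k) = F x + A (intVec k) := by
  choose l hl using hF.translate
  have hadd : ∀ j k, intVec (l (j + k)) = intVec (l j) + intVec (l k) := by
    intro j k
    have h1 := hl (j + k) 0
    rw [intVec_add, ← add_assoc, hl k, hl j, add_assoc] at h1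
    exact (add_left_cancel h1).symm ▸ rfl
  let φ : (Fin 2 → ℤ) →+ Plane := AddMonoidHom.mk' (fun k => intVec (l k)) hadd
  let A : Plane →ₗ[ℝ] Plane :=
    { toFun := fun x => ∑ i, x i • φ (Pi.single i 1)
      map_add' := fun x y => by simp [add_smul, Finset.sum_add_distrib]
      map_smul' := fun c x => by simp [mul_smul] }
  refine ⟨LinearMap.toContinuousLinearMap A, fun k x => ?_⟩
  rw [hl k x]
  congr 1
  change φ k = ∑ i, intVec k i • φ (Pi.single i 1)
  conv_lhs => rw [← Finset.univ_sum_single k, map_sum]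
  refine Finset.sum_congr rfl fun i _ => ?_
  have : (Pi.single i (k i) : Fin 2 → ℤ) = k i • Pi.single i 1 := by
    rw [← Pi.single_smul]; simp
  rw [this, map_zsmul, intVec_apply, Int.cast_smul_eq_zsmul]

/-- `F - A` is periodic, so a bound on the unit square is global: at large scale `F` acts as `A`. -/
theorem exists_norm_sub_le_of_add_intVec {F : Plane → Plane} (hF : Continuous F)
    {A : Plane →L[ℝ] Plane} (h : ∀ k x, F (x + intVec k) = F x + A (intVec k)) :
    ∃ C, ∀ x, ‖F x - A x‖ ≤ C := by
  obtain ⟨C, hC⟩ := isCompact_unitSquare.exists_bound_of_continuousOn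
    (f := fun x => F x - A x) (by fun_prop)
  refine ⟨C, fun x => ?_⟩
  obtain ⟨y, hy, k, rfl⟩ := exists_unitSquare_add_intVec x
  have := hC y hy
  rwa [h, map_add, add_sub_add_right_eq_sub]

theorem linear_ext_intVec {A B : Plane →L[ℝ] Plane} (h : ∀ k, A (intVec k) = B (intVec k)) :
    A = B := by
  ext1 x
  have hx : x = ∑ i, x i • intVec (Pi.single i 1) := by
    ext j
    fin_cases j <;> simp
  rw [hx]
  simp [h]

/-- Comparing integer increments in `H ∘ G = id + const` gives `A ∘ B = id`. `B` serves to pull the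
target shape back through `H`. -/
theorem TorusDiffeo.exists_linear_rightInverse {h : TorusDiffeo} {H : Plane → Plane}
    (hH : IsLift H h) {A : Plane →L[ℝ] Plane}
    (hA : ∀ k x, H (x + intVec k) = H x + A (intVec k)) :
    ∃ B : Plane →L[ℝ] Plane, ∀ x, A (B x) = x := by
  obtain ⟨G, hG, -⟩ := h.smooth_invFun
  obtain ⟨B, hB⟩ := hG.exists_linear
  have h1 : h.toFun ∘ h.invFun = id := funext h.right_inv
  obtain ⟨k, hk⟩ := (h1 ▸ hH.comp hG).eq_add_intVec
    (show IsLift id id from ⟨continuous_id, fun _ => rfl⟩)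
  refine ⟨B, fun x => ?_⟩
  have : A.comp B = ContinuousLinearMap.id ℝ Plane := by
    refine linear_ext_intVec fun j => ?_
    obtain ⟨l, hl⟩ := hG.translate j
    have e1 : B (intVec j) = intVec l := by
      have := (hB j 0).symm.trans (hl 0)
      exact add_left_cancel this
    have e2 := hk (0 + intVec j)
    have e3 := hk 0
    simp only [Function.comp_apply, id] at e2 e3
    rw [hl, hA, e3] at e2
    rw [ContinuousLinearMap.comp_apply, e1]
    simpa [add_comm] using e2
  exact congrArg (fun T : Plane →L[ℝ] Plane => T x) this

/-! ### Convergence of all derivatives -/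

/-- Writing a partial derivative as a restriction of the joint one makes it continuous in the point
and the parameter together. -/
theorem iteratedFDeriv_comp_prodMk {E F G : Type*} [NormedAddCommGroup E] [NormedSpace ℝ E]
    [NormedAddCommGroup F] [NormedSpace ℝ F] [NormedAddCommGroup G] [NormedSpace ℝ G]
    {U : E × F → G} (hU : ContDiff ℝ ∞ U) (j : ℕ) (x : E) (β : F) :
    iteratedFDeriv ℝ j (fun y => U (y, β)) x =
      (iteratedFDeriv ℝ j U (x, β)).compContinuousLinearMap
        fun _ => ContinuousLinearMap.inl ℝ E F := by
  have h1 : (fun y => U (y, β)) = (fun p => U (p + (0, β))) ∘ ContinuousLinearMap.inl ℝ E F := by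
    funext y; simp
  have h2 : ContDiff ℝ ∞ fun p : E × F => U (p + (0, β)) :=
    hU.comp (contDiff_id.add contDiff_const)
  rw [h1, ContinuousLinearMap.iteratedFDeriv_comp_right _ h2 x (by exact_mod_cast le_top),
    iteratedFDeriv_comp_add_right]
  simp

theorem continuous_iteratedFDeriv_comp_prodMk {E F G : Type*} [NormedAddCommGroup E]
    [NormedSpace ℝ E] [NormedAddCommGroup F] [NormedSpace ℝ F] [NormedAddCommGroup G]
    [NormedSpace ℝ G] {U : E × F → G} (hU : ContDiff ℝ ∞ U) (j : ℕ) :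
    Continuous fun p : E × F => iteratedFDeriv ℝ j (fun y => U (y, p.2)) p.1 := by
  simp_rw [iteratedFDeriv_comp_prodMk hU]
  exact (ContinuousMultilinearMap.compContinuousLinearMapL
    fun _ => ContinuousLinearMap.inl ℝ E F).continuous.comp
      (hU.continuous_iteratedFDeriv (by exact_mod_cast le_top))

/-- The conjugated translations `A (B y + β)` depend on `β` continuously, uniformly on the plane
and for all derivatives. -/
theorem eventually_iteratedFDeriv_sub_lt {A B : Plane → Plane} {a b : Torus → Torus}
    (hA : IsLift A a) (hB : IsLift B b) (hAs : ContDiff ℝ ∞ A) (hBs : ContDiff ℝ ∞ B)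
    (β₀ : Plane) (j : ℕ) {ε : ℝ} (hε : 0 < ε) :
    ∀ᶠ β in 𝓝 β₀, ∀ x, ‖iteratedFDeriv ℝ j (fun y => A (B y + β)) x -
      iteratedFDeriv ℝ j (fun y => A (B y + β₀)) x‖ < ε := by
  have hU : ContDiff ℝ ∞ fun p : Plane × Plane => A (B p.1 + p.2) :=
    hAs.comp ((hBs.comp contDiff_fst).add contDiff_snd)
  have hc := continuous_iteratedFDeriv_comp_prodMk hU j
  have hs : ∀ β, ContDiff ℝ ∞ fun y => A (B y + β) := fun β =>
    hAs.comp (hBs.add contDiff_const)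
  have hD : ∀ᶠ β in 𝓝 β₀, ∀ x ∈ unitSquare, ‖iteratedFDeriv ℝ j (fun y => A (B y + β)) x -
      iteratedFDeriv ℝ j (fun y => A (B y + β₀)) x‖ < ε := by
    refine isCompact_unitSquare.eventually_forall_of_forall_eventually fun x _ => ?_
    have h1 : Continuous fun z : Plane × Plane =>
        ‖iteratedFDeriv ℝ j (fun y => A (B y + z.1)) z.2 -
          iteratedFDeriv ℝ j (fun y => A (B y + β₀)) z.2‖ :=
      ((hc.comp continuous_swap).sub
        (hc.comp (continuous_snd.prodMk continuous_const))).norm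
    refine h1.continuousAt.eventually_lt continuousAt_const ?_
    simpa using hε
  filter_upwards [hD] with β hβ x
  obtain ⟨y, hy, k, rfl⟩ := exists_unitSquare_add_intVec x
  have hj : ∀ β, ContDiff ℝ j fun y => A (B y + β) := fun β =>
    (hs β).of_le (by exact_mod_cast le_top)
  -- Each conjugated translation is only equivariant, but the difference of two is periodic. This
  -- carries the estimate from the square to the plane.
  have hper : (fun z => A (B (z + intVec k) + β) - A (B (z + intVec k) + β₀)) =
      fun z => A (B z + β) - A (B z + β₀) := by
    obtain ⟨l, hl⟩ := hB.translate k
    obtain ⟨m, hm⟩ := hA.translate l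
    funext z
    rw [hl, add_right_comm, hm, add_right_comm _ (intVec l), hm, add_sub_add_right_eq_sub]
  have := hβ y hy
  rw [← iteratedFDeriv_sub_apply (hj β).contDiffAt (hj β₀).contDiffAt] at this ⊢
  rw [← iteratedFDeriv_comp_add_right]
  exact (congrArg (fun u => ‖iteratedFDeriv ℝ j u y‖) hper).trans_lt this

/-! ### Shears of the torus -/

/-- A smooth `1`-periodic function that vanishes near `0` and near `2τ`, and equals `1` near `τ`,
unless `τ` is an integer. -/
def shearProfile (τ s : ℝ) : ℝ :=
  Real.smoothTransition (3 * (Real.cos (2 * Real.pi * (s - τ)) - Real.cos (2 * Real.pi * τ)) /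
    (1 - Real.cos (2 * Real.pi * τ)) - 1)

theorem shearProfile_mem_Icc (τ s : ℝ) : shearProfile τ s ∈ Set.Icc (0 : ℝ) 1 :=
  ⟨Real.smoothTransition.nonneg _, Real.smoothTransition.le_one _⟩

theorem contDiff_shearProfile (τ : ℝ) : ContDiff ℝ ∞ (shearProfile τ) := by
  refine (Real.smoothTransition.contDiff (n := ⊤)).comp ?_
  fun_prop

theorem shearProfile_add_int (τ s : ℝ) (n : ℤ) :
    shearProfile τ (s + n) = shearProfile τ s := by
  have : Real.cos (2 * Real.pi * (s + n - τ)) = Real.cos (2 * Real.pi * (s - τ)) := by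
    rw [← Real.cos_add_int_mul_two_pi (2 * Real.pi * (s - τ)) n]
    ring_nf
  rw [shearProfile, this, shearProfile]

theorem one_sub_cos_two_pi_mul_pos {τ : ℝ} (hτ : ∀ n : ℤ, τ ≠ n) :
    0 < 1 - Real.cos (2 * Real.pi * τ) := by
  refine sub_pos.2 ((Real.cos_le_one _).lt_of_ne fun h => ?_)
  obtain ⟨n, hn⟩ := (Real.cos_eq_one_iff _).1 h
  refine hτ n ?_
  have := Real.pi_pos
  have h2 : (2 * Real.pi) * (n - τ) = 0 := by linarith
  rcases mul_eq_zero.1 h2 with h3 | h3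
  · linarith
  · linarith

/-- The hypothesis means `s ≡ 0` or `s ≡ 2τ` modulo `1`. There the argument of the smooth transition
is `-1`, strictly below `0`; at `s ≡ τ` with `τ` not an integer it is `2`, strictly above `1`. Hence
the profile is locally constant at these points. -/
theorem shearProfile_eventually_eq_zero {τ s : ℝ}
    (hs : Real.cos (2 * Real.pi * (s - τ)) = Real.cos (2 * Real.pi * τ)) :
    ∀ᶠ u in 𝓝 s, shearProfile τ u = 0 := by
  have hc : Continuous fun u => 3 * (Real.cos (2 * Real.pi * (u - τ)) -
      Real.cos (2 * Real.pi * τ)) / (1 - Real.cos (2 * Real.pi * τ)) - 1 := by fun_prop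
  have h := hc.continuousAt.eventually_lt (x₀ := s) (continuousAt_const (y := (0 : ℝ)))
    (by simp [hs])
  filter_upwards [h] with u hu
  exact Real.smoothTransition.zero_of_nonpos hu.le

theorem shearProfile_eventually_eq_one {τ s : ℝ} (hτ : ∀ n : ℤ, τ ≠ n)
    (hs : Real.cos (2 * Real.pi * (s - τ)) = 1) :
    ∀ᶠ u in 𝓝 s, shearProfile τ u = 1 := by
  have hc : Continuous fun u => 3 * (Real.cos (2 * Real.pi * (u - τ)) -
      Real.cos (2 * Real.pi * τ)) / (1 - Real.cos (2 * Real.pi * τ)) - 1 := by fun_prop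
  have h0 := one_sub_cos_two_pi_mul_pos hτ
  have h := (continuousAt_const (y := (1 : ℝ))).eventually_lt (x₀ := s) hc.continuousAt
    (by rw [hs, mul_div_cancel_right₀ _ h0.ne']; norm_num)
  filter_upwards [h] with u hu
  exact Real.smoothTransition.one_of_one_le hu.le

theorem cos_two_pi_mul_int_add (n : ℤ) (x : ℝ) :
    Real.cos (2 * Real.pi * (n + x)) = Real.cos (2 * Real.pi * x) := by
  rw [← Real.cos_add_int_mul_two_pi (2 * Real.pi * x) n]
  ring_nf

/-- A shift by `τ` climbs the bump from `n` to `n + τ` and descends it from `n + τ` to `n + 2τ`, so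
one profile yields both signs. -/
theorem shearProfile_sub_eventually_eq_one {τ : ℝ} (hτ : ∀ n : ℤ, τ ≠ n) (n : ℤ) :
    ∀ᶠ u in 𝓝 (n : ℝ), shearProfile τ (u + τ) - shearProfile τ u = 1 := by
  have h1 : ∀ᶠ u in 𝓝 (n : ℝ), shearProfile τ u = 0 :=
    shearProfile_eventually_eq_zero (by
      rw [sub_eq_add_neg, cos_two_pi_mul_int_add, mul_neg, Real.cos_neg])
  have h2 : ∀ᶠ u in 𝓝 (n : ℝ), shearProfile τ (u + τ) = 1 :=
    (continuous_add_const τ).continuousAt.eventually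
      (shearProfile_eventually_eq_one hτ (s := n + τ) (by
        rw [add_sub_cancel_right]; simpa using cos_two_pi_mul_int_add n 0))
  filter_upwards [h1, h2] with u hu hu'
  rw [hu, hu', sub_zero]

theorem shearProfile_sub_eventually_eq_neg_one {τ : ℝ} (hτ : ∀ n : ℤ, τ ≠ n) (n : ℤ) :
    ∀ᶠ u in 𝓝 (n + τ), shearProfile τ (u + τ) - shearProfile τ u = -1 := by
  have h1 : ∀ᶠ u in 𝓝 (n + τ), shearProfile τ u = 1 :=
    shearProfile_eventually_eq_one hτ (by
      rw [add_sub_cancel_right]; simpa using cos_two_pi_mul_int_add n 0)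
  have h2 : ∀ᶠ u in 𝓝 (n + τ), shearProfile τ (u + τ) = 0 :=
    (continuous_add_const τ).continuousAt.eventually
      (shearProfile_eventually_eq_zero (s := n + τ + τ) (by
        rw [add_sub_cancel_right, cos_two_pi_mul_int_add]))
  filter_upwards [h1, h2] with u hu hu'
  rw [hu, hu', zero_sub]

/-- The determinant of `(N, x)`, as a linear form in `x`. -/
def detForm (N : Fin 2 → ℤ) (x : Plane) : ℝ := N 0 * x 1 - N 1 * x 0

theorem detForm_add (N : Fin 2 → ℤ) (x y : Plane) :
    detForm N (x + y) = detForm N x + detForm N y := by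
  simp [detForm]; ring

theorem detForm_smul (N : Fin 2 → ℤ) (c : ℝ) (x : Plane) :
    detForm N (c • x) = c * detForm N x := by
  simp [detForm]; ring

theorem detForm_self (N : Fin 2 → ℤ) : detForm N (intVec N) = 0 := by
  simp [detForm]; ring

theorem detForm_intVec (N k : Fin 2 → ℤ) : detForm N (intVec k) = (N 0 * k 1 - N 1 * k 0 : ℤ) := by
  simp [detForm]

theorem contDiff_detForm (N : Fin 2 → ℤ) : ContDiff ℝ ∞ (detForm N) := by
  unfold detForm
  fun_prop

/-- Average over translations by `γ s`, which preserve `μ` and leave `α` unchanged. By Fubini the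
integral over `s` can be taken first, and it absorbs the shift by `α x`. -/
theorem measurePreserving_add_comp_of_invariant {X C : Type*} [AddCommGroup X] [MeasurableSpace X]
    [MeasurableAdd₂ X] [AddCommGroup C] [MeasurableSpace C] [MeasurableAdd₂ C]
    {μ : Measure X} [SFinite μ] [μ.IsAddRightInvariant] {ν : Measure C} [IsProbabilityMeasure ν]
    [ν.IsAddRightInvariant] {γ : C →+ X} (hγ : Measurable γ) {α : X → C} (hα : Measurable α)
    (h : ∀ x s, α (x + γ s) = α x) : MeasurePreserving (fun x => x + γ (α x)) μ μ := by
  have hT : Measurable fun x => x + γ (α x) := by fun_prop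
  refine ⟨hT, Measure.ext_of_lintegral _ fun f hf => ?_⟩
  rw [lintegral_map hf hT]
  have h1 : ∀ s, ∫⁻ x, f (x + γ (α x)) ∂μ = ∫⁻ x, f (x + γ (s + α x)) ∂μ := fun s => by
    rw [← lintegral_add_right_eq_self _ (γ s)]
    simp only [h, map_add, add_assoc]
  have h2 : ∀ x, ∫⁻ s, f (x + γ (s + α x)) ∂ν = ∫⁻ s, f (x + γ s) ∂ν := fun x =>
    lintegral_add_right_eq_self (fun s => f (x + γ s)) (α x)
  calc ∫⁻ x, f (x + γ (α x)) ∂μ = ∫⁻ _s, ∫⁻ x, f (x + γ (α x)) ∂μ ∂ν := by simp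
    _ = ∫⁻ s, ∫⁻ x, f (x + γ (s + α x)) ∂μ ∂ν := lintegral_congr h1
    _ = ∫⁻ x, ∫⁻ s, f (x + γ (s + α x)) ∂ν ∂μ := by
      rw [lintegral_lintegral_swap]
      fun_prop
    _ = ∫⁻ x, ∫⁻ s, f (x + γ s) ∂ν ∂μ := lintegral_congr h2
    _ = ∫⁻ s, ∫⁻ x, f (x + γ s) ∂μ ∂ν := by
      rw [lintegral_lintegral_swap]
      fun_prop
    _ = ∫⁻ _s, ∫⁻ x, f x ∂μ ∂ν := lintegral_congr fun s => lintegral_add_right_eq_self f _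
    _ = ∫⁻ x, f x ∂μ := by simp

/-- The closed one-parameter subgroup of the torus in the direction `N`. -/
def circleHom (N : Fin 2 → ℤ) : UnitAddCircle →+ Torus where
  toFun s i := N i • s
  map_zero' := by funext i; simp
  map_add' s u := by funext i; simp

/-- The linear form `detForm N` on the torus. -/
def torusDetForm (N : Fin 2 → ℤ) (x : Torus) : UnitAddCircle := N 0 • x 1 - N 1 • x 0

theorem torusDetForm_torusProj (N : Fin 2 → ℤ) (x : Plane) :
    torusDetForm N (torusProj x) = (detForm N x : UnitAddCircle) := by
  simp only [torusDetForm, torusProj_apply, detForm, AddCircle.coe_sub, ← AddCircle.coe_zsmul,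
    zsmul_eq_mul]

theorem torusDetForm_add_circleHom (N : Fin 2 → ℤ) (x : Torus) (s : UnitAddCircle) :
    torusDetForm N (x + circleHom N s) = torusDetForm N x := by
  simp only [torusDetForm, circleHom, AddMonoidHom.coe_mk, ZeroHom.coe_mk, Pi.add_apply, smul_add,
    smul_smul, mul_comm (N 1)]
  abel

/-- The map of the circle induced by a periodic function. -/
def circleProfile {g : ℝ → ℝ} (hg : Function.Periodic g 1) : UnitAddCircle → UnitAddCircle :=
  Function.Periodic.lift (f := fun s => (g s : UnitAddCircle)) fun s => congrArg _ (hg s)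

theorem circleProfile_coe {g : ℝ → ℝ} (hg : Function.Periodic g 1) (s : ℝ) :
    circleProfile hg (s : UnitAddCircle) = (g s : UnitAddCircle) := rfl

theorem continuous_circleProfile {g : ℝ → ℝ} (hg : Function.Periodic g 1) (hgc : Continuous g) :
    Continuous (circleProfile hg) :=
  continuous_quot_lift _ ((AddCircle.continuous_mk' 1).comp hgc)

/-- The shear of the plane in the direction `N` with profile `g`. -/
def planeShear (N : Fin 2 → ℤ) (g : ℝ → ℝ) (x : Plane) : Plane := x + g (detForm N x) • intVec N

theorem contDiff_planeShear (N : Fin 2 → ℤ) {g : ℝ → ℝ} (hg : ContDiff ℝ ∞ g) :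
    ContDiff ℝ ∞ (planeShear N g) :=
  contDiff_id.add ((hg.comp (contDiff_detForm N)).smul contDiff_const)

/-- The shear of the torus in the direction `N` with profile `g`. -/
def torusShear (N : Fin 2 → ℤ) {g : ℝ → ℝ} (hg : Function.Periodic g 1) (x : Torus) : Torus :=
  x + circleHom N (circleProfile hg (torusDetForm N x))

theorem isLift_planeShear (N : Fin 2 → ℤ) {g : ℝ → ℝ} (hg : Function.Periodic g 1)
    (hgs : ContDiff ℝ ∞ g) : IsLift (planeShear N g) (torusShear N hg) := by
  refine ⟨(contDiff_planeShear N hgs).continuous, fun x => ?_⟩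
  rw [torusShear, torusDetForm_torusProj, circleProfile_coe, planeShear, torusProj_add]
  congr 1
  funext i
  simp only [circleHom, torusProj_apply, AddMonoidHom.coe_mk, ZeroHom.coe_mk, PiLp.smul_apply,
    intVec_apply, smul_eq_mul, ← AddCircle.coe_zsmul, zsmul_eq_mul, mul_comm]

theorem isSmoothTorusMap_torusShear (N : Fin 2 → ℤ) {g : ℝ → ℝ} (hg : Function.Periodic g 1)
    (hgs : ContDiff ℝ ∞ g) : IsSmoothTorusMap (torusShear N hg) :=
  ⟨_, isLift_planeShear N hg hgs, contDiff_planeShear N hgs⟩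

theorem torusShear_torusShear (N : Fin 2 → ℤ) {g g' : ℝ → ℝ} (hg : Function.Periodic g 1)
    (hg' : Function.Periodic g' 1) (h : ∀ s, g s + g' s = 0) (x : Torus) :
    torusShear N hg (torusShear N hg' x) = x := by
  obtain ⟨s, hs⟩ := QuotientAddGroup.mk_surjective (torusDetForm N x)
  have hs' : torusDetForm N x = (s : UnitAddCircle) := hs.symm
  rw [torusShear, torusShear, torusDetForm_add_circleHom, hs', circleProfile_coe,
    circleProfile_coe, add_assoc, ← map_add, ← AddCircle.coe_add, add_comm (g' s), h]
  simp

/-- The shear of the torus in the direction `N` with profile `g`, as a diffeomorphism. -/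
def TorusDiffeo.shear (N : Fin 2 → ℤ) {g : ℝ → ℝ} (hg : Function.Periodic g 1)
    (hgs : ContDiff ℝ ∞ g) : TorusDiffeo where
  toFun := torusShear N hg
  invFun := torusShear N (g := -g) fun s => by simp [hg s]
  left_inv := torusShear_torusShear N _ _ fun s => by simp
  right_inv := torusShear_torusShear N _ _ fun s => by simp
  smooth_toFun := isSmoothTorusMap_torusShear N _ hgs
  smooth_invFun := isSmoothTorusMap_torusShear N _ hgs.neg

theorem TorusDiffeo.measurePreserving_shear (N : Fin 2 → ℤ) {g : ℝ → ℝ}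
    (hg : Function.Periodic g 1) (hgs : ContDiff ℝ ∞ g) :
    MeasurePreserving (TorusDiffeo.shear N hg hgs) volume volume := by
  have h1 : Continuous (circleHom N) := by
    change Continuous fun s : UnitAddCircle => fun i => N i • s
    fun_prop
  have h2 : Continuous (torusDetForm N) := by
    unfold torusDetForm
    fun_prop
  have h3 : IsProbabilityMeasure (volume : Measure UnitAddCircle) := ⟨by simp⟩
  exact measurePreserving_add_comp_of_invariant (ν := (volume : Measure UnitAddCircle))
    h1.measurable ((continuous_circleProfile hg hgs.continuous).comp h2).measurable
    fun x s => by simp only [torusDetForm_add_circleHom]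

/-! ### Compositions of rapidly oscillating shears -/

theorem int_ne_mul_sqrt_two {m : ℤ} (hm : m ≠ 0) (n : ℤ) : m * √2 ≠ n :=
  (irrational_sqrt_two.intCast_mul hm).ne_int n

/-- The vector `(0, √2)`. -/
def sqrtTwoVec : Plane := WithLp.toLp 2 ![0, √2]

theorem detForm_sqrtTwoVec (N : Fin 2 → ℤ) : detForm N sqrtTwoVec = N 0 * √2 := by
  simp [detForm, sqrtTwoVec]

/-- Near every point there are points at which the linear form `detForm N`, multiplied by a large
multiple of `q`, takes a value congruent to a given one modulo the integers. -/
theorem eventually_exists_detForm_eq {N : Fin 2 → ℤ} (hN : N 0 ≠ 0) {q : ℕ} (hq : 0 < q) (r : ℝ)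
    {U : Set Plane} {x₀ : Plane} (hU : U ∈ 𝓝 x₀) :
    ∀ᶠ k : ℕ in atTop, ∃ x ∈ U, ∃ n : ℤ,
      ((q * k : ℕ) : ℝ) * detForm N x = n + ((q * k : ℕ) : ℝ) * r := by
  have hN' : (N 0 : ℝ) ≠ 0 := by exact_mod_cast hN
  set e : Plane := WithLp.toLp 2 ![0, (N 0 : ℝ)⁻¹] with he
  have hNe : detForm N e = 1 := by simp [detForm, he, hN']
  set s₀ := detForm N x₀
  -- The point of `r + Q⁻¹ℤ` nearest to `s₀`, where `Q = q * k`; it is within `1 / (2Q)`.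
  set s : ℕ → ℝ := fun k => (round (((q * k : ℕ) : ℝ) * (s₀ - r)) : ℝ) / ((q * k : ℕ) : ℝ) + r
  have hQ : Tendsto (fun k : ℕ => ((q * k : ℕ) : ℝ)) atTop atTop :=
    tendsto_natCast_atTop_atTop.comp (Filter.tendsto_id.const_mul_atTop' hq)
  have hs : Tendsto s atTop (𝓝 s₀) := by
    rw [tendsto_iff_dist_tendsto_zero]
    have h2 : Tendsto (fun k : ℕ => ((q * k : ℕ) : ℝ)⁻¹) atTop (𝓝 0) :=
      tendsto_inv_atTop_zero.comp hQ
    refine squeeze_zero' (Eventually.of_forall fun _ => dist_nonneg) ?_ h2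
    filter_upwards [hQ.eventually_gt_atTop 0] with k hk
    have h3 := abs_sub_round (((q * k : ℕ) : ℝ) * (s₀ - r))
    have h4 : s k - s₀ = -(((q * k : ℕ) : ℝ) * (s₀ - r) - round (((q * k : ℕ) : ℝ) * (s₀ - r))) /
        ((q * k : ℕ) : ℝ) := by
      simp only [s]
      field_simp
      ring
    rw [Real.dist_eq, h4, abs_div, abs_neg, abs_of_pos hk, ← one_div]
    gcongr
    linarith
  have hx : Tendsto (fun k => x₀ + (s k - s₀) • e) atTop (𝓝 x₀) := by
    have : Tendsto (fun k => x₀ + (s k - s₀) • e) atTop (𝓝 (x₀ + (s₀ - s₀) • e)) :=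
      ((hs.sub_const s₀).smul_const e).const_add x₀
    simpa using this
  filter_upwards [hx hU, hQ.eventually_gt_atTop 0] with k hk hk0
  refine ⟨_, hk, round (((q * k : ℕ) : ℝ) * (s₀ - r)), ?_⟩
  rw [detForm_add, detForm_smul, hNe]
  simp only [s]
  field_simp
  ring

theorem inv_smul_intVec_mul {q : ℕ} (N k : Fin 2 → ℤ) (m : ℕ) (hq : 0 < q) :
    ∃ n : ℤ, ((q * m : ℕ) : ℝ) * detForm N ((q : ℝ)⁻¹ • intVec k) = n := by
  refine ⟨m * (N 0 * k 1 - N 1 * k 0), ?_⟩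
  have : (q : ℝ) ≠ 0 := by positivity
  rw [detForm_smul, detForm_intVec]
  push_cast
  field_simp

/-- There are area-preserving diffeomorphisms of the torus, commuting with a given finite group of
rotations, such that the displacement of the conjugated translation `Φ (Φ⁻¹ x + t)` stays in the
zonotope generated by given integer vectors, up to the translation by `t`, and attains all the
sums of the generators with signs. -/
theorem exists_torusDiffeo_displacement {ι : Type*} [Fintype ι] [DecidableEq ι]
    {N : ι → Fin 2 → ℤ} (hN : ∀ i, N i 0 ≠ 0) {q : ℕ} (hq : 0 < q) (s : Finset ι) :
    ∃ (φ : TorusDiffeo) (Φ : Plane → Plane), IsLift Φ φ ∧ MeasurePreserving φ volume volume ∧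
      (∀ k x, Φ (x + (q : ℝ)⁻¹ • intVec k) = Φ x + (q : ℝ)⁻¹ • intVec k) ∧
      (∀ x, ∃ d : ι → ℝ, (∀ i, |d i| ≤ 1) ∧
        Φ (x + sqrtTwoVec) = Φ x + sqrtTwoVec + ∑ i ∈ s, d i • intVec (N i)) ∧
      ∀ σ : ι → ℤˣ, ∃ x, ∀ᶠ y in 𝓝 x,
        Φ (y + sqrtTwoVec) = Φ y + sqrtTwoVec + intVec (∑ i ∈ s, (σ i : ℤ) • N i) := by
  induction s using Finset.induction_on with
  | empty =>
    have hid : IsSmoothTorusMap id := ⟨id, ⟨continuous_id, fun _ => rfl⟩, contDiff_id⟩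
    exact ⟨⟨Equiv.refl _, hid, hid⟩, id, ⟨continuous_id, fun _ => rfl⟩, MeasurePreserving.id _,
      fun _ _ => rfl, fun x => ⟨0, by simp, by simp⟩, fun σ => ⟨0, by simp⟩⟩
  | insert j s hj ih =>
    obtain ⟨φ, Φ, hΦ, hφ, hcomm, hd, hσ⟩ := ih
    obtain ⟨Φ', hΦ', -, hΦΦ', hΦ'Φ⟩ := TorusDiffeo.exists_inverse_lift hΦ
    set t := sqrtTwoVec
    -- The earlier shears realise `σ` on an open set. A fast enough oscillation meets there both the
    -- points where the new shear jumps by `1` and those where it jumps by `-1`.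
    have key : ∀ σ : ι → ℤˣ, ∀ᶠ k : ℕ in atTop, ∃ x, (∀ᶠ y in 𝓝 x,
        Φ (y + t) = Φ y + t + intVec (∑ i ∈ s, (σ i : ℤ) • N i)) ∧
        ∃ n : ℤ, ((q * k : ℕ) : ℝ) * detForm (N j) (Φ x) =
          n + ((q * k : ℕ) : ℝ) * if σ j = 1 then 0 else detForm (N j) t := by
      intro σ
      obtain ⟨x₀, hx₀⟩ := hσ σ
      have hU : {y | ∀ᶠ z in 𝓝 (Φ' y),
          Φ (z + t) = Φ z + t + intVec (∑ i ∈ s, (σ i : ℤ) • N i)} ∈ 𝓝 (Φ x₀) := by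
        have h := hx₀.eventually_nhds
        rw [← hΦ'Φ x₀] at h
        exact hΦ'.1.continuousAt.eventually h
      filter_upwards [eventually_exists_detForm_eq (hN j) hq
        (if σ j = 1 then 0 else detForm (N j) t) hU] with k hk
      obtain ⟨y, hy, n, hn⟩ := hk
      exact ⟨_, hy, n, by rwa [hΦΦ']⟩
    -- There are finitely many sign patterns, so a single frequency serves them all.
    obtain ⟨k, hk, hkpos⟩ := ((eventually_all.2 key).and (eventually_gt_atTop 0)).exists
    set Q : ℕ := q * k with hQ
    have hQ0 : Q ≠ 0 := (Nat.mul_pos hq hkpos).ne'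
    set τ : ℝ := Q * detForm (N j) t with hτ
    have hτn : ∀ n : ℤ, τ ≠ n := by
      intro n
      have h1 : ((Q : ℤ) * N j 0 : ℤ) ≠ 0 := mul_ne_zero (by exact_mod_cast hQ0) (hN j)
      have h2 := int_ne_mul_sqrt_two h1 n
      rw [hτ, detForm_sqrtTwoVec, ← mul_assoc]
      exact_mod_cast h2
    set g : ℝ → ℝ := fun u => shearProfile τ (Q * u) with hg
    have hgper : Function.Periodic g 1 := fun u => by
      have := shearProfile_add_int τ (Q * u) Q
      simpa [hg, mul_add] using this
    have hgs : ContDiff ℝ ∞ g := (contDiff_shearProfile τ).comp (by fun_prop)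
    -- The frequency is a multiple of `q`, so the new shear commutes with the translations by
    -- `q⁻¹ℤ²`.
    have hgq : ∀ (u : ℝ) (l : Fin 2 → ℤ), g (u + detForm (N j) ((q : ℝ)⁻¹ • intVec l)) = g u := by
      intro u l
      obtain ⟨n, hn⟩ := inv_smul_intVec_mul (N j) l k hq
      simp only [hg, mul_add, hQ, hn, shearProfile_add_int]
    have hstep : ∀ x, planeShear (N j) g (Φ (x + t)) = planeShear (N j) g (Φ x) +
        (Φ (x + t) - Φ x) + (g (detForm (N j) (Φ (x + t))) - g (detForm (N j) (Φ x))) •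
          intVec (N j) := fun x => by
      simp only [planeShear, sub_smul]; abel
    refine ⟨(TorusDiffeo.shear (N j) hgper hgs).comp φ, planeShear (N j) g ∘ Φ,
      (isLift_planeShear (N j) hgper hgs).comp hΦ,
      (TorusDiffeo.measurePreserving_shear (N j) hgper hgs).comp hφ, ?_, ?_, ?_⟩
    · intro l x
      simp only [Function.comp_apply, hcomm, planeShear, detForm_add, hgq]
      abel
    · intro x
      obtain ⟨d, hd1, hd2⟩ := hd x
      refine ⟨Function.update d j (g (detForm (N j) (Φ (x + t))) - g (detForm (N j) (Φ x))),
        fun i => ?_, ?_⟩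
      · rcases eq_or_ne i j with rfl | hij
        · have h1 := shearProfile_mem_Icc τ (Q * detForm (N i) (Φ (x + t)))
          have h2 := shearProfile_mem_Icc τ (Q * detForm (N i) (Φ x))
          rw [Function.update_self, abs_le]
          simp only [hg]
          exact ⟨by linarith [h1.1, h2.2], by linarith [h1.2, h2.1]⟩
        · rw [Function.update_of_ne hij]; exact hd1 i
      · rw [Finset.sum_insert hj, Function.update_self, Function.comp_apply, hstep]
        have h3 : ∑ i ∈ s, Function.update d j (g (detForm (N j) (Φ (x + t))) -
            g (detForm (N j) (Φ x))) i • intVec (N i) = ∑ i ∈ s, d i • intVec (N i) :=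
          Finset.sum_congr rfl fun i hi => by
            rw [Function.update_of_ne (ne_of_mem_of_not_mem hi hj)]
        rw [h3]
        have h4 : Φ (x + t) - Φ x = t + ∑ i ∈ s, d i • intVec (N i) := by rw [hd2]; abel
        rw [h4, Function.comp_apply]
        abel
    · intro σ
      obtain ⟨x, hx, n, hn⟩ := hk σ
      refine ⟨x, ?_⟩
      have hcont : ContinuousAt (fun y => Q * detForm (N j) (Φ y)) x :=
        (continuous_const.mul ((contDiff_detForm (N j)).continuous.comp hΦ.1)).continuousAt
      have hjump : ∀ᶠ u in 𝓝 (Q * detForm (N j) (Φ x)),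
          shearProfile τ (u + τ) - shearProfile τ u = ((σ j : ℤ) : ℝ) := by
        rw [hn]
        rcases Int.units_eq_one_or (σ j) with h | h
        · simpa [h] using shearProfile_sub_eventually_eq_one hτn n
        · simpa [h] using shearProfile_sub_eventually_eq_neg_one hτn n
      filter_upwards [hx, hcont.eventually hjump] with y hy hy'
      rw [Finset.sum_insert hj, Function.comp_apply, hstep, Function.comp_apply]
      -- Near `x` the displacement of `Φ` differs from `t` by an integer vector, so the phase
      -- advances by `τ` modulo the integers.
      have h5 : g (detForm (N j) (Φ (y + t))) = shearProfile τ (Q * detForm (N j) (Φ y) + τ) := by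
        rw [hy, detForm_add, detForm_add, detForm_intVec]
        have := shearProfile_add_int τ (Q * detForm (N j) (Φ y) + τ)
          (Q * (N j 0 * (∑ i ∈ s, (σ i : ℤ) • N i) 1 - N j 1 * (∑ i ∈ s, (σ i : ℤ) • N i) 0))
        rw [← this]
        simp only [hg, hτ]
        push_cast
        congr 1
        ring
      rw [h5, hy', hy, intVec_add, intVec_zsmul]
      abel

/-! ### Symmetric planar convex bodies and zonotopes -/

/-- The total variation of a quasiconcave finite sequence. -/
theorem exists_sum_abs_sub_eq {c : ℕ → ℝ} {m : ℕ}
    (hc : ∀ i j k, i ≤ j → j ≤ k → k ≤ m → min (c i) (c k) ≤ c j) :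
    ∃ i ≤ m, ∑ j ∈ Finset.range m, |c (j + 1) - c j| = 2 * c i - c 0 - c m := by
  obtain ⟨i, hi, hmax⟩ := Finset.exists_max_image (Finset.range (m + 1)) c ⟨0, by simp⟩
  have him : i ≤ m := Nat.lt_succ_iff.1 (Finset.mem_range.1 hi)
  replace hmax : ∀ j ≤ m, c j ≤ c i := fun j hj => hmax j (by simp; omega)
  refine ⟨i, him, ?_⟩
  -- The sequence rises to its maximum and then falls. Reflecting the falling part makes the
  -- absolute increments telescope.
  let f : ℕ → ℝ := fun j => if j ≤ i then c j else 2 * c i - c j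
  have hf : ∀ j ∈ Finset.range m, |c (j + 1) - c j| = f (j + 1) - f j := by
    intro j hj
    have hjm : j < m := Finset.mem_range.1 hj
    rcases lt_trichotomy j i with h | rfl | h
    · have h1 := hc j (j + 1) i (by omega) (by omega) him
      rw [min_eq_left (hmax j hjm.le)] at h1
      rw [abs_of_nonneg (by linarith)]
      simp only [f]
      rw [if_pos (by omega), if_pos (by omega)]
    · have h1 := hmax (j + 1) (by omega)
      rw [abs_of_nonpos (by linarith)]
      simp only [f]
      rw [if_neg (by omega), if_pos le_rfl]
      ring
    · have h1 := hc i j (j + 1) (by omega) (by omega) (by omega)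
      rw [min_eq_right (hmax (j + 1) (by omega))] at h1
      rw [abs_of_nonpos (by linarith)]
      simp only [f]
      rw [if_neg (by omega), if_neg (by omega)]
      ring
  rw [Finset.sum_congr rfl hf, Finset.sum_range_sub]
  simp only [f, Nat.zero_le, if_true]
  split_ifs with h
  · rw [le_antisymm him h]; ring
  · ring

theorem clm_plane_apply (f : Plane →L[ℝ] ℝ) (z : Plane) :
    f z = z 0 * f (EuclideanSpace.single 0 1) + z 1 * f (EuclideanSpace.single 1 1) := by
  have hz : z = z 0 • EuclideanSpace.single 0 1 + z 1 • EuclideanSpace.single 1 1 := by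
    ext j
    fin_cases j <;> simp
  conv_lhs => rw [hz]
  simp

/-- `p a` is a highest point of `K` on the vertical line of abscissa `a`. -/
def IsTopPoint (K : Set Plane) (a : ℝ) (z : Plane) : Prop :=
  z ∈ K ∧ z 0 = a ∧ ∀ y ∈ K, y 0 = a → y 1 ≤ z 1

/-- The upper boundary is a concave graph, so a linear form that does not decrease upwards is
quasiconcave along it. -/
theorem IsTopPoint.min_le {K : Set Plane} (hK : Convex ℝ K) {f : Plane →L[ℝ] ℝ}
    (hf : 0 ≤ f (EuclideanSpace.single 1 1)) {a b c : ℝ} {x y z : Plane} (hx : IsTopPoint K a x)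
    (hy : IsTopPoint K b y) (hz : IsTopPoint K c z) (hab : a ≤ b) (hbc : b ≤ c) :
    min (f x) (f z) ≤ f y := by
  obtain ⟨l, m, hl, hm, hlm, hb⟩ : b ∈ segment ℝ a c := by
    rw [segment_eq_Icc (hab.trans hbc)]; exact ⟨hab, hbc⟩
  have hmem : l • x + m • z ∈ K := hK hx.1 hz.1 hl hm hlm
  have h0 : (l • x + m • z) 0 = b := by
    simpa [hx.2.1, hz.2.1] using hb
  have h1 := hy.2.2 _ hmem h0
  have h2 : f (l • x + m • z) ≤ f y := by
    rw [clm_plane_apply f y, clm_plane_apply f (l • x + m • z), h0, hy.2.1]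
    gcongr
  have h3 : min (f x) (f z) ≤ l * f x + m * f z := by
    have e1 := mul_le_mul_of_nonneg_left (min_le_left (f x) (f z)) hl
    have e2 := mul_le_mul_of_nonneg_left (min_le_right (f x) (f z)) hm
    calc min (f x) (f z) = (l + m) * min (f x) (f z) := by rw [hlm, one_mul]
      _ ≤ _ := by linarith
  rw [map_add, map_smul, map_smul, smul_eq_mul, smul_eq_mul] at h2
  exact h3.trans h2

theorem exists_isTopPoint {K : Set Plane} (hK : IsCompact K) {x : Plane} (hx : x ∈ K) :
    ∃ z, IsTopPoint K (x 0) z := by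
  have hc : IsCompact (K ∩ {y | y 0 = x 0}) :=
    hK.inter_right (isClosed_eq (by fun_prop) continuous_const)
  obtain ⟨z, hz, hmax⟩ := hc.exists_isMaxOn ⟨x, hx, rfl⟩
    (f := fun y : Plane => y 1) (by fun_prop)
  exact ⟨z, hz.1, hz.2, fun y hy hy0 => hmax ⟨hy, hy0⟩⟩

/-- The zonotope generated by `w`. -/
def zonotope {ι : Type*} [Fintype ι] (w : ι → Plane) : Set Plane :=
  {z | ∃ d : ι → ℝ, (∀ i, |d i| ≤ 1) ∧ ∑ i, d i • w i = z}

theorem convex_zonotope {ι : Type*} [Fintype ι] (w : ι → Plane) : Convex ℝ (zonotope w) := by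
  rintro _ ⟨d, hd, rfl⟩ _ ⟨e, he, rfl⟩ a b ha hb hab
  refine ⟨fun i => a * d i + b * e i, fun i => ?_, ?_⟩
  · calc |a * d i + b * e i| ≤ |a * d i| + |b * e i| := abs_add_le _ _
      _ = a * |d i| + b * |e i| := by rw [abs_mul, abs_mul, abs_of_nonneg ha, abs_of_nonneg hb]
      _ ≤ a * 1 + b * 1 := by gcongr <;> simp [hd, he]
      _ = 1 := by linarith
  · simp [add_smul, mul_smul, Finset.sum_add_distrib, Finset.smul_sum]

theorem neg_mem_zonotope {ι : Type*} [Fintype ι] {w : ι → Plane} {z : Plane}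
    (hz : z ∈ zonotope w) : -z ∈ zonotope w := by
  obtain ⟨d, hd, rfl⟩ := hz
  exact ⟨fun i => -d i, by simpa using hd, by simp⟩

/-- The support function of the zonotope is `∑ i, |f (w i)|`; Hahn–Banach turns a comparison of
support functions into an inclusion. -/
theorem zonotope_subset {ι : Type*} [Fintype ι] {w : ι → Plane} {K : Set Plane}
    (hK : IsClosed K) (hKc : Convex ℝ K)
    (h : ∀ f : Plane →L[ℝ] ℝ, ∃ k ∈ K, ∑ i, |f (w i)| ≤ f k) : zonotope w ⊆ K := by
  rintro _ ⟨d, hd, rfl⟩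
  by_contra hz
  obtain ⟨f, u, hu, hu'⟩ := geometric_hahn_banach_closed_point hKc hK hz
  obtain ⟨k, hk, hfk⟩ := h f
  have h1 : f (∑ i, d i • w i) ≤ ∑ i, |f (w i)| := by
    rw [map_sum]
    refine Finset.sum_le_sum fun i _ => ?_
    rw [map_smul, smul_eq_mul]
    refine (le_abs_self _).trans ?_
    rw [abs_mul]
    exact mul_le_of_le_one_left (abs_nonneg _) (hd i)
  linarith [hu k hk]

/-- A symmetric planar compact convex set contains zonotopes that approximate it. -/
theorem exists_zonotope {K : Set Plane} (hK : IsCompact K) (hKc : Convex ℝ K) (hne : K.Nonempty)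
    (hs : ∀ x ∈ K, -x ∈ K) {ε : ℝ} (hε : 0 < ε) :
    ∃ (m : ℕ) (w : Fin m → Plane), zonotope w ⊆ K ∧ ∀ x ∈ K, ∃ z ∈ zonotope w, dist x z < ε := by
  classical
  obtain ⟨T, hTK, hTfin, hT⟩ := hK.finite_cover_balls hε
  obtain ⟨x₀, hx₀⟩ := hne
  -- Abscissas of a finite `ε`-net of `K`, made symmetric so that the lower boundary over `X` is the
  -- opposite of the upper one.
  set X : Finset ℝ := (hTfin.toFinset ∪ hTfin.toFinset.image Neg.neg).image fun z => z 0 with hX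
  have hXK : ∀ a ∈ X, ∃ x ∈ K, x 0 = a := by
    intro a ha
    simp only [hX, Finset.mem_image, Finset.mem_union, Set.Finite.mem_toFinset] at ha
    obtain ⟨z, hz | ⟨y, hy, rfl⟩, rfl⟩ := ha
    · exact ⟨z, hTK hz, rfl⟩
    · exact ⟨-y, hs y (hTK hy), rfl⟩
  have hXT : ∀ z ∈ T, z 0 ∈ X := fun z hz =>
    Finset.mem_image_of_mem _ (Finset.mem_union_left _ (hTfin.mem_toFinset.2 hz))
  have hXneg : ∀ a ∈ X, -a ∈ X := by
    intro a ha
    simp only [hX, Finset.mem_image, Finset.mem_union, Set.Finite.mem_toFinset] at ha ⊢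
    obtain ⟨z, hz | ⟨y, hy, rfl⟩, rfl⟩ := ha
    · exact ⟨-z, Or.inr ⟨z, hz, rfl⟩, rfl⟩
    · exact ⟨y, Or.inl hy, by simp⟩
  have hXne : X.Nonempty := by
    obtain ⟨y, hy, -⟩ := Set.mem_iUnion₂.1 (hT hx₀)
    exact ⟨_, hXT y hy⟩
  have htop : ∀ a : ℝ, ∃ z, a ∈ X → IsTopPoint K a z := by
    intro a
    by_cases ha : a ∈ X
    · obtain ⟨x, hx, rfl⟩ := hXK a ha
      obtain ⟨z, hz⟩ := exists_isTopPoint hK hx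
      exact ⟨z, fun _ => hz⟩
    · exact ⟨0, fun h => absurd h ha⟩
  choose p hp using htop
  obtain ⟨m, hm⟩ : ∃ m, X.card = m + 1 := Nat.exists_eq_succ_of_ne_zero hXne.card_pos.ne'
  set e := X.orderEmbOfFin hm with he
  have heX : ∀ i, e i ∈ X := fun i => X.orderEmbOfFin_mem hm i
  have hsurj : ∀ a ∈ X, ∃ i, e i = a := fun a ha => by
    have : a ∈ Set.range e := by rw [he, Finset.range_orderEmbOfFin]; exact ha
    exact this
  have hlast : e (Fin.last m) = -e 0 := by
    obtain ⟨i, hi⟩ := hsurj _ (hXneg _ (heX 0))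
    obtain ⟨j, hj⟩ := hsurj _ (hXneg _ (heX (Fin.last m)))
    have h1 := e.monotone (Fin.le_last i)
    have h2 := e.monotone (Fin.zero_le j)
    linarith
  -- Vertices of the upper chain from left to right. The default value matters: at index `m + 1` it
  -- closes the half polygon at the point opposite to `q 0`. The generators are the half edges.
  let q : ℕ → Plane := fun i => if h : i < m + 1 then p (e ⟨i, h⟩) else -p (e 0)
  have hq : ∀ i (h : i < m + 1), q i = p (e ⟨i, h⟩) := fun i h => dif_pos h
  have hq0 : q 0 = p (e 0) := hq 0 (by omega)
  have hqlast : q (m + 1) = -q 0 := by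
    rw [hq0]; exact dif_neg (by omega)
  have hqtop : ∀ i (h : i < m + 1), IsTopPoint K (e ⟨i, h⟩) (q i) := fun i h => by
    rw [hq i h]; exact hp _ (heX _)
  set w : Fin (m + 1) → Plane := fun i => (1 / 2 : ℝ) • (q (i + 1) - q i) with hw
  have hsum : ∀ f : Plane →L[ℝ] ℝ, 0 ≤ f (EuclideanSpace.single 1 1) →
      ∃ k ∈ K, ∑ i, |f (w i)| = f k := by
    intro f hf
    obtain ⟨i, hi, hsum⟩ := exists_sum_abs_sub_eq (c := fun i => f (q i)) (m := m)
      fun i j k hij hjk hk => (hqtop i (by omega)).min_le hKc hf (hqtop j (by omega))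
        (hqtop k (by omega)) (e.monotone hij) (e.monotone hjk)
    refine ⟨q i, (hqtop i (by omega)).1, ?_⟩
    have h1 : ∀ i, |f (w i)| = 1 / 2 * |f (q (i + 1)) - f (q i)| := fun i => by
      rw [hw, map_smul, map_sub, smul_eq_mul, abs_mul, abs_of_pos (by norm_num : (0 : ℝ) < 1 / 2)]
    -- The last edge is vertical and descends, as `-q 0` lies on the same vertical line as the top
    -- point `q m`. Its variation therefore combines with that of the chain to give exactly `f (q
    -- i)`.
    have h2 : f (q (m + 1)) - f (q m) ≤ 0 := by
      have hm' := hqtop m (by omega)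
      have h0 := hqtop 0 (by omega)
      have h3 : (-q 0) 0 = e (Fin.last m) := by
        rw [hlast, PiLp.neg_apply, h0.2.1]; rfl
      have h4 := hm'.2.2 _ (hs _ h0.1) h3
      rw [hqlast, clm_plane_apply f (-q 0), clm_plane_apply f (q m), h3, hm'.2.1]
      have := mul_le_mul_of_nonneg_right h4 hf
      change e (Fin.last m) * _ + _ - (e (Fin.last m) * _ + _) ≤ 0
      linarith
    simp_rw [h1]
    rw [← Finset.mul_sum, Fin.sum_univ_eq_sum_range (fun i => |f (q (i + 1)) - f (q i)|),
      Finset.sum_range_succ, hsum, abs_of_nonpos h2, hqlast, map_neg]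
    ring
  refine ⟨m + 1, w, zonotope_subset hK.isClosed hKc fun f => ?_, ?_⟩
  · rcases le_total 0 (f (EuclideanSpace.single 1 1)) with hf | hf
    · obtain ⟨k, hk, h⟩ := hsum f hf
      exact ⟨k, hk, h.le⟩
    · obtain ⟨k, hk, h⟩ := hsum (-f) (by simpa using hf)
      refine ⟨-k, hs k hk, ?_⟩
      simpa using h.le
  · have hqZ : ∀ k < m + 1, q k ∈ zonotope w := by
      intro k hk
      -- Edges before the vertex `k` count positively and later ones negatively. The sum is `q k -
      -- (q 0 + q (m + 1)) / 2`, and the ends cancel.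
      refine ⟨fun i => if (i : ℕ) < k then 1 else -1, fun i => by dsimp only; split_ifs <;> simp, ?_⟩
      let g : ℕ → Plane := fun i => (1 / 2 : ℝ) • if i ≤ k then q i else (2 : ℝ) • q k - q i
      have h2 : ∀ i ∈ Finset.range (m + 1),
          (if i < k then (1 : ℝ) else -1) • (1 / 2 : ℝ) • (q (i + 1) - q i) = g (i + 1) - g i := by
        intro i _
        simp only [g]
        rcases lt_trichotomy i k with h | rfl | h
        · rw [if_pos h, if_pos (by omega), if_pos (by omega)]
          module
        · rw [if_neg (by omega), if_neg (by omega), if_pos le_rfl]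
          module
        · rw [if_neg (by omega), if_neg (by omega), if_neg (by omega)]
          module
      rw [hw, Fin.sum_univ_eq_sum_range
        (fun i => (if i < k then (1 : ℝ) else -1) • (1 / 2 : ℝ) • (q (i + 1) - q i)),
        Finset.sum_congr rfl h2, Finset.sum_range_sub]
      simp only [g]
      rw [if_neg (by omega), if_pos (Nat.zero_le _), hqlast]
      module
    have hpZ : ∀ a ∈ X, p a ∈ zonotope w := by
      intro a ha
      obtain ⟨i, rfl⟩ := hsurj a ha
      rw [← hq i i.2]
      exact hqZ i i.2
    intro x hx
    obtain ⟨z, hz, hxz⟩ := Set.mem_iUnion₂.1 (hT hx)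
    refine ⟨z, ?_, hxz⟩
    have hza := hXT z hz
    have h1 := (hp _ hza).2.2 z (hTK hz) rfl
    have h2 := (hp _ (hXneg _ hza)).2.2 (-z) (hs z (hTK hz)) rfl
    have h3 : (-p (-z 0)) 1 ≤ z 1 := by
      simp only [PiLp.neg_apply] at h2 ⊢
      linarith
    obtain ⟨a, b, ha, hb, hab, habz⟩ : z 1 ∈ segment ℝ ((-p (-z 0)) 1) (p (z 0) 1) := by
      rw [segment_eq_Icc (h3.trans h1)]; exact ⟨h3, h1⟩
    -- A net point lies on the vertical segment between the lower and the upper boundary points,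
    -- both in the zonotope.
    have h4 : z = a • (-p (-z 0)) + b • p (z 0) := by
      have e1 : p (z 0) 0 = z 0 := (hp _ hza).2.1
      have e2 : p (-z 0) 0 = -z 0 := (hp _ (hXneg _ hza)).2.1
      ext j
      fin_cases j
      · simp only [Fin.zero_eta, PiLp.add_apply, PiLp.smul_apply, PiLp.neg_apply, e1, e2,
          smul_eq_mul, neg_neg]
        rw [← add_mul, hab, one_mul]
      · simpa using habz.symm
    rw [h4]
    exact convex_zonotope w (neg_mem_zonotope (hpZ _ (hXneg _ hza))) (hpZ _ hza) ha hb hab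

/-- Greedy choice: each new sign opposes the current error. One step changes the error by at most
`2`, so it never leaves `[-2, 2]`. -/
theorem exists_units_sum_sub_le {d : ℝ} (hd : |d| ≤ 1) (M : ℕ) :
    ∃ σ : ℕ → ℤˣ, |∑ k ∈ Finset.range M, ((σ k : ℤ) : ℝ) - M * d| ≤ 2 := by
  induction M with
  | zero => exact ⟨1, by simp⟩
  | succ M ih =>
    obtain ⟨σ, hσ⟩ := ih
    have hsum : ∀ u : ℤˣ, ∑ k ∈ Finset.range M, ((Function.update σ M u k : ℤ) : ℝ) =
        ∑ k ∈ Finset.range M, ((σ k : ℤ) : ℝ) := fun u =>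
      Finset.sum_congr rfl fun k hk => by
        rw [Function.update_of_ne (Finset.mem_range.1 hk).ne]
    rw [abs_le] at hσ hd
    rcases le_total 0 (∑ k ∈ Finset.range M, ((σ k : ℤ) : ℝ) - M * d) with h | h
    · refine ⟨Function.update σ M (-1), ?_⟩
      rw [Finset.sum_range_succ, hsum, Function.update_self, abs_le]
      push_cast
      constructor <;> linarith
    · refine ⟨Function.update σ M 1, ?_⟩
      rw [Finset.sum_range_succ, hsum, Function.update_self, abs_le]
      push_cast
      constructor <;> linarith

/-- A symmetric planar compact convex set contains a zonotope such that the sums of its generators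
with signs form an `ε`-net. -/
theorem exists_zonotope_signs {K : Set Plane} (hK : IsCompact K) (hKc : Convex ℝ K)
    (hne : K.Nonempty) (hs : ∀ x ∈ K, -x ∈ K) {ε : ℝ} (hε : 0 < ε) :
    ∃ (ι : Type) (_ : Fintype ι) (w : ι → Plane), zonotope w ⊆ K ∧
      ∀ x ∈ K, ∃ σ : ι → ℤˣ, dist x (∑ i, ((σ i : ℤ) : ℝ) • w i) < ε := by
  obtain ⟨m, w, hw, hw'⟩ := exists_zonotope hK hKc hne hs (half_pos hε)
  set S := ∑ i, ‖w i‖ with hS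
  have hS0 : 0 ≤ S := Finset.sum_nonneg fun i _ => norm_nonneg _
  obtain ⟨M, hM⟩ := exists_nat_gt (max 1 (2 * S / (ε / 2)))
  have hM0 : (0 : ℝ) < M := by linarith [le_max_left 1 (2 * S / (ε / 2))]
  have hM1 : 2 * S / M < ε / 2 := by
    have h := (le_max_right _ _).trans_lt hM
    rw [div_lt_iff₀ (by positivity)] at h
    rw [div_lt_iff₀ hM0]
    linarith
  -- Each generator is split into `M` copies of its `M`-th part. The zonotope stays inside `K`, and
  -- signed sums approximate any coefficient within `2 / M`.
  refine ⟨Fin m × Fin M, inferInstance, fun i => (M : ℝ)⁻¹ • w i.1, ?_, fun x hx => ?_⟩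
  · rintro _ ⟨d, hd, rfl⟩
    refine hw ⟨fun i => (M : ℝ)⁻¹ * ∑ k, d (i, k), fun i => ?_, ?_⟩
    · rw [abs_mul, abs_of_pos (by positivity), inv_mul_le_iff₀ hM0, mul_one]
      calc |∑ k, d (i, k)| ≤ ∑ k, |d (i, k)| := Finset.abs_sum_le_sum_abs _ _
        _ ≤ ∑ _k : Fin M, 1 := Finset.sum_le_sum fun k _ => hd _
        _ = M := by simp
    · rw [Fintype.sum_prod_type]
      refine Finset.sum_congr rfl fun i _ => ?_
      simp only [smul_smul]
      rw [← Finset.sum_smul, ← Finset.sum_mul, mul_comm]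
  · obtain ⟨_, ⟨d, hd, rfl⟩, hz⟩ := hw' x hx
    choose σ hσ using fun i => exists_units_sum_sub_le (hd i) M
    refine ⟨fun i => σ i.1 i.2, ?_⟩
    have h1 : ∑ i : Fin m × Fin M, ((σ i.1 i.2 : ℤ) : ℝ) • (M : ℝ)⁻¹ • w i.1 =
        ∑ i, ((∑ k ∈ Finset.range M, ((σ i k : ℤ) : ℝ)) * (M : ℝ)⁻¹) • w i := by
      rw [Fintype.sum_prod_type]
      refine Finset.sum_congr rfl fun i _ => ?_
      simp only [smul_smul]
      rw [← Finset.sum_smul, ← Finset.sum_mul,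
        Fin.sum_univ_eq_sum_range (fun k => ((σ i k : ℤ) : ℝ))]
    have h2 : dist (∑ i, d i • w i)
        (∑ i, ((∑ k ∈ Finset.range M, ((σ i k : ℤ) : ℝ)) * (M : ℝ)⁻¹) • w i) ≤ 2 * S / M := by
      rw [dist_eq_norm, ← Finset.sum_sub_distrib, hS, Finset.mul_sum, Finset.sum_div]
      refine (norm_sum_le _ _).trans (Finset.sum_le_sum fun i _ => ?_)
      rw [← sub_smul, norm_smul, Real.norm_eq_abs, mul_div_right_comm]
      gcongr
      have h3 : d i - (∑ k ∈ Finset.range M, ((σ i k : ℤ) : ℝ)) * (M : ℝ)⁻¹ =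
          -(∑ k ∈ Finset.range M, ((σ i k : ℤ) : ℝ) - M * d i) / M := by
        field_simp
        ring
      rw [h3, abs_div, abs_neg, abs_of_pos hM0]
      gcongr
      exact hσ i
    rw [h1]
    calc _ ≤ _ := dist_triangle x (∑ i, d i • w i) _
      _ < ε / 2 + ε / 2 := by linarith
      _ = ε := by ring

/-! ### Diffeomorphisms with iterates of a prescribed shape -/

/-- Up to an error `δ` in the Hausdorff distance, the set `S` is a translate of `ρ • K`. -/
def HomotheticWithin (δ ρ : ℝ) (S K : Set Plane) : Prop :=
  ∃ v : Plane, (∀ x ∈ S, ∃ k ∈ K, dist x (ρ • k + v) ≤ δ) ∧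
    ∀ k ∈ K, ∃ x ∈ S, dist x (ρ • k + v) ≤ δ

/-- The diffeomorphisms having an iterate that maps the unit square to a set which is large and
homothetic to `K`, up to a relative error less than `η`. -/
def shapeSet (K : Set Plane) (η : ℝ) : Set TorusDiffeo :=
  {f | ∃ F, IsLift F f ∧ ∃ (n : ℕ) (ρ δ : ℝ), η⁻¹ < ρ ∧ δ < η * ρ ∧
    HomotheticWithin δ ρ (F^[n] '' unitSquare) K}

/-- Induction on `n`, using uniform continuity of `F` near the compact set `F^[n] '' D` only. -/
theorem exists_dist_iterate_lt {X : Type*} [PseudoMetricSpace X] {F : X → X} (hF : Continuous F)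
    {D : Set X} (hD : IsCompact D) (n : ℕ) {ε : ℝ} (hε : 0 < ε) :
    ∃ δ > 0, ∀ G : X → X, (∀ x, dist (F x) (G x) < δ) →
      ∀ x ∈ D, dist (F^[n] x) (G^[n] x) < ε := by
  induction n generalizing ε with
  | zero => exact ⟨1, one_pos, fun G _ x _ => by simpa using hε⟩
  | succ n ih =>
    have hC : IsCompact (F^[n] '' D) := hD.image (hF.iterate n)
    have hu := hC.uniformContinuousAt_of_continuousAt F (fun x _ => hF.continuousAt)
      (Metric.dist_mem_uniformity (half_pos hε))
    obtain ⟨δ, hδ, hδ'⟩ := Metric.mem_uniformity_dist.1 hu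
    obtain ⟨δ', hδ'pos, h⟩ := ih hδ
    refine ⟨min δ' (ε / 2), lt_min hδ'pos (half_pos hε), fun G hG x hx => ?_⟩
    have h1 := h G (fun y => (hG y).trans_le (min_le_left _ _)) x hx
    have h2 : dist (F (F^[n] x)) (F (G^[n] x)) < ε / 2 := hδ' h1 ⟨x, hx, rfl⟩
    have h3 := (hG (G^[n] x)).trans_le (min_le_right _ _)
    rw [Function.iterate_succ_apply', Function.iterate_succ_apply']
    calc _ ≤ _ := dist_triangle _ (F (G^[n] x)) _
      _ < ε / 2 + ε / 2 := add_lt_add h2 h3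
      _ = ε := add_halves ε

theorem norm_iteratedFDeriv_zero_sub (F G : Plane → Plane) (x : Plane) :
    ‖iteratedFDeriv ℝ 0 F x - iteratedFDeriv ℝ 0 G x‖ = dist (F x) (G x) := by
  rw [iteratedFDeriv_zero_eq_comp, iteratedFDeriv_zero_eq_comp, Function.comp_apply,
    Function.comp_apply, ← map_sub, LinearIsometryEquiv.norm_map, dist_eq_norm]

/-- Only `C⁰` closeness is used: the strict inequality `δ < η * ρ` leaves room for half of the gap.
-/
theorem isOpen_shapeSet (K : Set Plane) (η : ℝ) : IsOpen (shapeSet K η) := by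
  rintro f ⟨F, hF, n, ρ, δ, hρ, hδ, v, h1, h2⟩
  obtain ⟨δ', hδ', hclose⟩ := exists_dist_iterate_lt hF.1 isCompact_unitSquare n
    (half_pos (sub_pos.2 hδ))
  refine ⟨0, δ', hδ', ?_⟩
  rintro g ⟨F', G', hF', hG', hFG⟩
  obtain ⟨c, hc⟩ := hF.eq_add_intVec hF'
  have h3 := hclose (fun x => G' x + intVec c) fun x => by
    have := hFG 0 le_rfl x
    rw [norm_iteratedFDeriv_zero_sub] at this
    rwa [hc x, dist_add_right]
  refine ⟨_, hG'.add_intVec c, n, ρ, (η * ρ + δ) / 2, hρ, by linarith, v, ?_, ?_⟩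
  · rintro _ ⟨x, hx, rfl⟩
    obtain ⟨k, hk, hxk⟩ := h1 _ ⟨x, hx, rfl⟩
    refine ⟨k, hk, (dist_triangle_left _ _ (F^[n] x)).trans ?_⟩
    linarith [h3 x hx]
  · intro k hk
    obtain ⟨_, ⟨x, hx, rfl⟩, hxk⟩ := h2 k hk
    refine ⟨_, ⟨x, hx, rfl⟩, (dist_triangle_left _ _ (F^[n] x)).trans ?_⟩
    linarith [h3 x hx]

/-- The first coordinate must be nonzero so that `detForm N sqrtTwoVec = N 0 * √2` is irrational.
This costs a larger, but still absolute, rounding error. -/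
theorem exists_intVec_norm_sub_le (x : Plane) : ∃ N, N 0 ≠ 0 ∧ ‖x - intVec N‖ ≤ 3 := by
  have h : ∃ n : ℤ, n ≠ 0 ∧ |x 0 - n| ≤ 2 := by
    by_cases h0 : round (x 0) = 0
    · refine ⟨1, one_ne_zero, ?_⟩
      have := abs_sub_round (x 0)
      rw [h0, abs_le] at this
      rw [abs_le]
      push_cast at this ⊢
      constructor <;> linarith
    · exact ⟨_, h0, (abs_sub_round (x 0)).trans (by norm_num)⟩
  obtain ⟨n, hn, hxn⟩ := h
  refine ⟨![n, round (x 1)], hn, ?_⟩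
  have h1 := abs_sub_round (x 1)
  rw [EuclideanSpace.norm_eq, Real.sqrt_le_left (by norm_num), Fin.sum_univ_two]
  simp only [PiLp.sub_apply, intVec_apply, Matrix.cons_val_zero, Matrix.cons_val_one,
    Real.norm_eq_abs]
  nlinarith [abs_nonneg (x 0 - n), abs_nonneg (x 1 - round (x 1))]

/-- Rational vectors are dense in the plane. -/
theorem exists_rational_mem {U : Set Plane} {θ : Plane} (hU : U ∈ 𝓝 θ) :
    ∃ (q : ℕ) (p : Fin 2 → ℤ), 0 < q ∧ (q : ℝ)⁻¹ • intVec p ∈ U := by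
  have hlim : Tendsto (fun q : ℕ => (q : ℝ)⁻¹ • intVec fun i => round (q * θ i)) atTop (𝓝 θ) := by
    rw [tendsto_iff_norm_sub_tendsto_zero]
    have h2 : Tendsto (fun q : ℕ => (q : ℝ)⁻¹ * 1) atTop (𝓝 (0 * 1)) :=
      tendsto_inv_atTop_nhds_zero_nat.mul_const 1
    rw [zero_mul] at h2
    refine squeeze_zero' (Eventually.of_forall fun _ => norm_nonneg _) ?_ h2
    filter_upwards [eventually_gt_atTop 0] with q hq
    have hq' : (0 : ℝ) < q := by exact_mod_cast hq
    have h3 : (q : ℝ)⁻¹ • intVec (fun i => round (q * θ i)) - θ =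
        (q : ℝ)⁻¹ • (intVec (fun i => round (q * θ i)) - (q : ℝ) • θ) := by
      rw [smul_sub, inv_smul_smul₀ hq'.ne']
    rw [h3, norm_smul, norm_inv, Real.norm_of_nonneg hq'.le]
    gcongr
    rw [EuclideanSpace.norm_eq, Real.sqrt_le_left (by norm_num), Fin.sum_univ_two]
    simp only [PiLp.sub_apply, intVec_apply, PiLp.smul_apply, smul_eq_mul, Real.norm_eq_abs]
    have h0 := abs_sub_round (q * θ 0)
    have h1 := abs_sub_round (q * θ 1)
    rw [abs_sub_comm] at h0 h1
    nlinarith [abs_nonneg (round (q * θ 0) - q * θ 0), abs_nonneg (round (q * θ 1) - q * θ 1)]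
  obtain ⟨q, hq, hq0⟩ := ((hlim.eventually hU).and (eventually_gt_atTop 0)).exists
  exact ⟨q, _, hq0, hq⟩

/-- The image of the unit square under a conjugate of the translation by `t` has the shape of the
set of displacements. -/
theorem homotheticWithin_of_displacement {H H' Φ Φ' : Plane → Plane} {h φ : TorusDiffeo}
    (hΦ : IsLift Φ φ) (hH' : IsLift H' h.invFun)
    (hΦ' : IsLift Φ' φ.invFun) (hΦΦ' : ∀ x, Φ (Φ' x) = x)
    {A B : Plane →L[ℝ] Plane} (hAB : ∀ x, A (B x) = x) {C₁ C₂ C₃ R ε : ℝ} (hR : 0 ≤ R)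
    (hC₁ : ∀ x, ‖H x - A x‖ ≤ C₁) {t : Plane}
    (hC₂ : ∀ x ∈ unitSquare, ‖A (H' x + t)‖ ≤ C₂) {K : Set Plane} {c : Plane}
    (h1 : ∀ x, ∃ k ∈ K, ‖Φ (x + t) - Φ x - t - R • B (k - c)‖ ≤ C₃)
    (h2 : ∀ k ∈ K, ∃ x, ‖Φ (x + t) - Φ x - t - R • B (k - c)‖ ≤ C₃ + R * ε) (hε : 0 ≤ ε)
    (b : Plane) :
    HomotheticWithin (C₁ + C₂ + ‖A‖ * (C₃ + R * ε)) R
      ((fun x => H (Φ (Φ' (H' x) + t)) + b) '' unitSquare) K := by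
  have key : ∀ x ∈ unitSquare, ∀ k,
      ‖Φ (Φ' (H' x) + t) - Φ (Φ' (H' x)) - t - R • B (k - c)‖ ≤ C₃ + R * ε →
      dist (H (Φ (Φ' (H' x) + t)) + b) (R • k + (b - R • c)) ≤
        C₁ + C₂ + ‖A‖ * (C₃ + R * ε) := by
    intro x hx k hk
    set y := Φ (Φ' (H' x) + t) with hy
    rw [hΦΦ'] at hk
    -- Three errors: `H` against its linear part, the bounded starting point, and the displacement
    -- against the target, magnified by `A`.
    have e1 : H y + b - (R • k + (b - R • c)) =
        (H y - A y) + A (H' x + t) + A (y - H' x - t - R • B (k - c)) := by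
      simp only [map_add, map_sub, map_smul, hAB, smul_sub]
      abel
    rw [dist_eq_norm, e1]
    refine (norm_add₃_le).trans ?_
    gcongr
    · exact hC₁ y
    · exact hC₂ x hx
    · exact (A.le_opNorm _).trans (by gcongr)
  refine ⟨b - R • c, ?_, fun k hk => ?_⟩
  · rintro _ ⟨x, hx, rfl⟩
    obtain ⟨k, hk, hxk⟩ := h1 (Φ' (H' x))
    exact ⟨k, hk, key x hx k (hxk.trans (by nlinarith [mul_nonneg hR hε]))⟩
  · obtain ⟨y, hy⟩ := h2 k hk
    -- The displacement is periodic, so the value at `y` is also attained from a point of the unit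
    -- square over the same point of the torus.
    obtain ⟨x, hx, hxy⟩ := exists_unitSquare_torusProj (h (φ (torusProj y)))
    refine ⟨_, ⟨x, hx, rfl⟩, key x hx k ?_⟩
    have e1 : torusProj (Φ' (H' x)) = torusProj y := by
      rw [hΦ'.2, hH'.2, hxy]
      exact (congrArg φ.invFun (h.left_inv _)).trans (φ.left_inv _)
    obtain ⟨l, hl⟩ := torusProj_eq_iff.1 e1
    obtain ⟨j, hj⟩ := hΦ.translate l
    rw [hl, add_right_comm, hj, hj, add_sub_add_right_eq_sub]
    exact hy

theorem norm_sum_smul_sub_sum_smul_le {ι : Type*} [Fintype ι] {d : ι → ℝ} (hd : ∀ i, |d i| ≤ 1)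
    {u v : ι → Plane} {C : ℝ} (h : ∀ i, ‖u i - v i‖ ≤ C) :
    ‖∑ i, d i • v i - ∑ i, d i • u i‖ ≤ Fintype.card ι * C := by
  rw [← Finset.sum_sub_distrib]
  calc _ ≤ ∑ i, ‖d i • v i - d i • u i‖ := norm_sum_le _ _
    _ ≤ ∑ _i : ι, C := Finset.sum_le_sum fun i _ => by
      rw [← smul_sub, norm_smul, norm_sub_rev]
      exact (mul_le_of_le_one_left (norm_nonneg _) (hd i)).trans (h i)
    _ = _ := by simp

/-- Every conjugate of a rotation is approximated by conjugates of rotations, with an iterate that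
maps the unit square to a set which is approximately homothetic to a prescribed symmetric convex
set. -/
theorem exists_conjRotation_mem_shapeSet (h : TorusDiffeo) (θ : Plane) {K : Set Plane}
    (hK : IsCompact K) (hKc : Convex ℝ K) (hne : K.Nonempty) (hs : IsPointSymmetric K) {η : ℝ}
    (hη : 0 < η) (k : ℕ) {ε : ℝ} (hε : 0 < ε) :
    ∃ φ : TorusDiffeo, MeasurePreserving φ volume volume ∧ ∃ β : Plane,
      (h.comp φ).conjRotation β ∈ shapeSet K η ∧
      ∀ f : TorusDiffeo, (∀ x, f x = h (h.invFun x + torusProj θ)) →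
        TorusDiffeo.CkClose k ε f ((h.comp φ).conjRotation β) := by
  classical
  obtain ⟨H, hH, hHs⟩ := h.smooth_toFun
  obtain ⟨H', hH', hH's, hHH', -⟩ := TorusDiffeo.exists_inverse_lift hH
  obtain ⟨A, hA⟩ := hH.exists_linear
  obtain ⟨B, hAB⟩ := TorusDiffeo.exists_linear_rightInverse hH hA
  obtain ⟨C₁, hC₁⟩ := exists_norm_sub_le_of_add_intVec hH.1 hA
  set t := sqrtTwoVec
  obtain ⟨C₂, hC₂⟩ := isCompact_unitSquare.exists_bound_of_continuousOn
    (f := fun x => A (H' x + t)) (by have := hH'.1; fun_prop)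
  obtain ⟨c, hc⟩ := hs
  -- This makes `‖A‖ * ε₁ ≤ η / 2`: half of the tolerance pays for the net, and `R` is then taken
  -- large enough for the other half to pay for the errors independent of `R`.
  set ε₁ : ℝ := η / (2 * (‖A‖ + 1)) with hε₁
  have hε₁pos : 0 < ε₁ := by positivity
  have hB : IsLinearMap ℝ B := B.toLinearMap.isLinear
  obtain ⟨ι, _, w, hw, hw'⟩ := exists_zonotope_signs (K := (fun x => B (x - c)) '' K)
    (hK.image (by fun_prop))
    (by
      have : (fun x => B (x - c)) '' K = B '' ((fun x => -c + x) '' K) := by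
        rw [Set.image_image]; simp [sub_eq_neg_add]
      rw [this]
      exact (hKc.translate (-c)).is_linear_image hB)
    (hne.image _)
    (by
      rintro _ ⟨x, hx, rfl⟩
      refine ⟨_, hc x hx, ?_⟩
      simp only [map_sub, map_smul]
      module) hε₁pos
  set C₃ : ℝ := Fintype.card ι * 3 with hC₃
  obtain ⟨R, hRη, hRC, hR0⟩ : ∃ R : ℝ, η⁻¹ < R ∧ (C₁ + C₂ + ‖A‖ * C₃) / (η / 2) < R ∧ 0 < R := by
    refine ⟨max (max η⁻¹ ((C₁ + C₂ + ‖A‖ * C₃) / (η / 2))) 0 + 1, ?_, ?_, ?_⟩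
    · linarith [le_max_left η⁻¹ ((C₁ + C₂ + ‖A‖ * C₃) / (η / 2)),
        le_max_left (max η⁻¹ ((C₁ + C₂ + ‖A‖ * C₃) / (η / 2))) 0]
    · linarith [le_max_right η⁻¹ ((C₁ + C₂ + ‖A‖ * C₃) / (η / 2)),
        le_max_left (max η⁻¹ ((C₁ + C₂ + ‖A‖ * C₃) / (η / 2))) 0]
    · linarith [le_max_right (max η⁻¹ ((C₁ + C₂ + ‖A‖ * C₃) / (η / 2))) 0]
  have hδ : C₁ + C₂ + ‖A‖ * (C₃ + R * ε₁) < η * R := by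
    rw [div_lt_iff₀ (by positivity)] at hRC
    have h1 : ‖A‖ * ε₁ ≤ η / 2 := by
      have : ‖A‖ * ε₁ ≤ (‖A‖ + 1) * ε₁ := by gcongr; linarith
      refine this.trans (le_of_eq ?_)
      rw [hε₁]
      field_simp
    have h2 := mul_le_mul_of_nonneg_right h1 hR0.le
    linarith
  choose N hN hN' using fun i => exists_intVec_norm_sub_le (R • w i)
  have hj : ∀ᶠ β in 𝓝 θ, ∀ j ∈ Finset.range (k + 1), ∀ x,
      ‖iteratedFDeriv ℝ j (fun y => H (H' y + β)) x -
        iteratedFDeriv ℝ j (fun y => H (H' y + θ)) x‖ < ε / 2 :=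
    (Finset.eventually_all _).2 fun j _ =>
      eventually_iteratedFDeriv_sub_lt hH hH' hHs hH's θ j (half_pos hε)
  -- The order of choices is essential: the denominator `q` precedes `φ`, which must commute with
  -- the translations by `q⁻¹ℤ²`, and `n` follows `φ`, whose derivatives are not controlled.
  obtain ⟨q, p, hq, hqp⟩ := exists_rational_mem hj
  obtain ⟨φ, Φ, hΦ, hφ, hcomm, hd, hσ⟩ := exists_torusDiffeo_displacement hN hq Finset.univ
  obtain ⟨Φ', hΦ', hΦ's, hΦΦ', -⟩ := TorusDiffeo.exists_inverse_lift hΦ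
  have hΦs := hΦ.contDiff φ.smooth_toFun
  set β₀ := (q : ℝ)⁻¹ • intVec p with hβ₀
  have hlim : Tendsto (fun n : ℕ => β₀ + ((q : ℝ) * n)⁻¹ • t) atTop (𝓝 β₀) := by
    have h1 : Tendsto (fun n : ℕ => ((q : ℝ) * n)⁻¹) atTop (𝓝 0) := by
      simp_rw [mul_inv]
      simpa using tendsto_inv_atTop_nhds_zero_nat.const_mul (q : ℝ)⁻¹
    simpa using (h1.smul_const t).const_add β₀
  have hj' : ∀ᶠ β in 𝓝 β₀, ∀ j ∈ Finset.range (k + 1), ∀ x,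
      ‖iteratedFDeriv ℝ j (fun y => (H ∘ Φ) ((Φ' ∘ H') y + β)) x -
        iteratedFDeriv ℝ j (fun y => (H ∘ Φ) ((Φ' ∘ H') y + β₀)) x‖ < ε / 2 :=
    (Finset.eventually_all _).2 fun j _ =>
      eventually_iteratedFDeriv_sub_lt (hH.comp hΦ) (hΦ'.comp hH') (hHs.comp hΦs)
        (hΦ's.comp hH's) β₀ j (half_pos hε)
  obtain ⟨n, hn, hn0⟩ := ((hlim.eventually hj').and (eventually_gt_atTop 0)).exists
  set β := β₀ + ((q : ℝ) * n)⁻¹ • t with hβ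
  have hlift : ∀ γ : Plane, IsLift (fun y => (H ∘ Φ) ((Φ' ∘ H') y + γ))
      fun x => (h.comp φ) ((h.comp φ).invFun x + torusProj γ) := by
    intro γ
    refine ⟨?_, fun x => ?_⟩
    · have := hH.1
      have := hH'.1
      have := hΦ.1
      have := hΦ'.1
      fun_prop
    · rw [(hH.comp hΦ).2, torusProj_add, (hΦ'.comp hH').2]
      rfl
  refine ⟨φ, hφ, β, ⟨_, hlift β, q * n, R, _, hRη, hδ, ?_⟩, fun f hf => ?_⟩
  · have hqn : ((q * n : ℕ) : ℝ) • β = t + intVec ((n : ℤ) • p) := by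
      have hq' : (q : ℝ) ≠ 0 := by positivity
      have hn' : (n : ℝ) ≠ 0 := by positivity
      rw [hβ, hβ₀, intVec_zsmul, smul_add, smul_smul, smul_smul, add_comm]
      push_cast
      congr 1
      · rw [mul_inv_cancel₀ (mul_ne_zero hq' hn'), one_smul]
      · congr 1
        field_simp
    have hrot : (q * n) • torusProj β = torusProj t := by
      rw [← torusProj_add_intVec t ((n : ℤ) • p), ← hqn]
      funext i
      simp [← AddCircle.coe_nsmul]
    have hit : IsLift (fun y => (H ∘ Φ) ((Φ' ∘ H') y + t))
        ((h.comp φ).conjRotation β)^[q * n] := by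
      have : (⇑((h.comp φ).conjRotation β).toEquiv)^[q * n] =
          fun x => (h.comp φ) ((h.comp φ).invFun x + torusProj t) := by
        funext x
        rw [← hrot]
        exact TorusDiffeo.conjRotation_iterate _ _ _ _
      exact this ▸ hlift t
    obtain ⟨b, hb⟩ := (IsLift.iterate (f := (h.comp φ).conjRotation β) (hlift β)
      (q * n)).eq_add_intVec hit
    rw [funext hb]
    refine homotheticWithin_of_displacement hΦ hH' hΦ' hΦΦ' hAB hR0.le hC₁ hC₂ (c := c) ?_ ?_
      hε₁pos.le (intVec b)
    · intro x
      obtain ⟨d, hd1, hd2⟩ := hd x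
      obtain ⟨κ, hκ, hκ'⟩ := hw ⟨d, hd1, rfl⟩
      refine ⟨κ, hκ, ?_⟩
      have e1 : Φ (x + t) - Φ x - t = ∑ i, d i • intVec (N i) := by rw [hd2]; abel
      have e2 : R • B (κ - c) = ∑ i, d i • R • w i := by
        rw [show B (κ - c) = _ from hκ', Finset.smul_sum]
        exact Finset.sum_congr rfl fun i _ => smul_comm _ _ _
      rw [e1, e2]
      exact norm_sum_smul_sub_sum_smul_le hd1 hN'
    · intro κ hκ
      obtain ⟨σ, hσκ⟩ := hw' _ ⟨κ, hκ, rfl⟩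
      obtain ⟨x, hx⟩ := hσ σ
      have hx' := hx.self_of_nhds
      refine ⟨x, ?_⟩
      have e1 : Φ (x + t) - Φ x - t = ∑ i, ((σ i : ℤ) : ℝ) • intVec (N i) := by
        rw [hx', intVec_sum]
        simp only [intVec_zsmul]
        abel
      have hσ1 : ∀ i, |((σ i : ℤ) : ℝ)| ≤ 1 := fun i => by
        rcases Int.units_eq_one_or (σ i) with h | h <;> simp [h]
      have e2 := norm_sum_smul_sub_sum_smul_le hσ1 hN'
      have e3 : ‖∑ i, ((σ i : ℤ) : ℝ) • R • w i - R • B (κ - c)‖ ≤ R * ε₁ := by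
        have : ∑ i, ((σ i : ℤ) : ℝ) • R • w i = R • ∑ i, ((σ i : ℤ) : ℝ) • w i := by
          rw [Finset.smul_sum]
          exact Finset.sum_congr rfl fun i _ => smul_comm _ _ _
        rw [this, ← smul_sub, norm_smul, Real.norm_of_nonneg hR0.le, ← dist_eq_norm, dist_comm]
        gcongr
      rw [e1]
      exact (norm_sub_le_norm_sub_add_norm_sub _ _ _).trans (add_le_add e2 e3)
  · refine ⟨fun y => H (H' y + θ), _, ⟨?_, fun x => ?_⟩, hlift β, fun j hjk x => ?_⟩
    · have := hH.1
      have := hH'.1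
      fun_prop
    · rw [hH.2, torusProj_add, hH'.2, hf]
    · have h1 := hqp j (Finset.mem_range_succ_iff.2 hjk) x
      have h2 := hn j (Finset.mem_range_succ_iff.2 hjk) x
      -- `Φ` commutes with the translation by `β₀`, so it cancels from the conjugate.
      have h3 : (fun y => (H ∘ Φ) ((Φ' ∘ H') y + β₀)) = fun y => H (H' y + β₀) := by
        funext y
        simp only [Function.comp_apply, hβ₀, hcomm, hΦΦ']
      rw [h3] at h2
      rw [norm_sub_rev] at h1 h2
      exact (norm_sub_le_norm_sub_add_norm_sub _ _ _).trans_lt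
        ((add_lt_add h1 h2).trans_eq (add_halves ε))

/-! ### Generic diffeomorphisms -/

theorem HomotheticWithin.of_close {δ ρ ε : ℝ} (hρ : 0 ≤ ρ) {S K K' : Set Plane}
    (h : HomotheticWithin δ ρ S K') (h1 : ∀ k ∈ K', ∃ k' ∈ K, dist k k' ≤ ε)
    (h2 : ∀ k ∈ K, ∃ k' ∈ K', dist k k' ≤ ε) : HomotheticWithin (δ + ρ * ε) ρ S K := by
  obtain ⟨v, hv1, hv2⟩ := h
  have key : ∀ x k k' : Plane, dist x (ρ • k + v) ≤ δ → dist k k' ≤ ε →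
      dist x (ρ • k' + v) ≤ δ + ρ * ε := by
    intro x k k' hx hk
    refine (dist_triangle _ _ _).trans (add_le_add hx ?_)
    rw [dist_add_right, dist_smul₀, Real.norm_of_nonneg hρ]
    gcongr
  refine ⟨v, fun x hx => ?_, fun k hk => ?_⟩
  · obtain ⟨k, hk, hxk⟩ := hv1 x hx
    obtain ⟨k', hk', hkk'⟩ := h1 k hk
    exact ⟨k', hk', key x k k' hxk hkk'⟩
  · obtain ⟨k', hk', hkk'⟩ := h2 k hk
    obtain ⟨x, hx, hxk⟩ := hv2 k' hk'
    exact ⟨x, hx, key x k' k hxk (dist_comm k k' ▸ hkk')⟩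

theorem HomotheticWithin.add_image {δ ρ : ℝ} {S K : Set Plane} (h : HomotheticWithin δ ρ S K)
    (b : Plane) : HomotheticWithin δ ρ ((fun x => x + b) '' S) K := by
  obtain ⟨v, hv1, hv2⟩ := h
  refine ⟨v + b, ?_, fun k hk => ?_⟩
  · rintro _ ⟨x, hx, rfl⟩
    obtain ⟨k, hk, hxk⟩ := hv1 x hx
    exact ⟨k, hk, by rwa [← add_assoc, dist_add_right]⟩
  · obtain ⟨x, hx, hxk⟩ := hv2 k hk
    exact ⟨_, ⟨x, hx, rfl⟩, by rwa [← add_assoc, dist_add_right]⟩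

/-- The rescaling factor of an approximate homothety is almost the ratio of the diameters. -/
theorem HomotheticWithin.abs_diam_sub_le {δ ρ : ℝ} (hρ : 0 ≤ ρ) {S K : Set Plane}
    (hS : Bornology.IsBounded S) (hK : Bornology.IsBounded K) (hne : K.Nonempty)
    (h : HomotheticWithin δ ρ S K) : |Metric.diam S - ρ * Metric.diam K| ≤ 2 * δ := by
  obtain ⟨v, hv1, hv2⟩ := h
  have hdist : ∀ k k' : Plane, dist (ρ • k + v) (ρ • k' + v) = ρ * dist k k' := fun k k' => by
    rw [dist_add_right, dist_smul₀, Real.norm_of_nonneg hρ]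
  have hδ : 0 ≤ δ := by
    obtain ⟨k, hk⟩ := hne
    obtain ⟨x, -, hx⟩ := hv2 k hk
    exact dist_nonneg.trans hx
  rw [abs_sub_le_iff, sub_le_iff_le_add, sub_le_iff_le_add]
  constructor
  · refine Metric.diam_le_of_forall_dist_le (by positivity) fun x hx y hy => ?_
    obtain ⟨k, hk, hxk⟩ := hv1 x hx
    obtain ⟨l, hl, hyl⟩ := hv1 y hy
    have h1 := dist_triangle4_right x y (ρ • k + v) (ρ • l + v)
    have h2 := mul_le_mul_of_nonneg_left (Metric.dist_le_diam_of_mem hK hk hl) hρ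
    rw [hdist] at h1
    linarith
  · have h0 : ∀ k ∈ K, ∀ l ∈ K, ρ * dist k l ≤ 2 * δ + Metric.diam S := by
      intro k hk l hl
      obtain ⟨x, hx, hxk⟩ := hv2 k hk
      obtain ⟨y, hy, hyl⟩ := hv2 l hl
      rw [← hdist]
      have h1 := dist_triangle4_left x y (ρ • k + v) (ρ • l + v)
      have h2 := Metric.dist_le_diam_of_mem hS hx hy
      linarith
    rcases hρ.eq_or_lt with rfl | hρ
    · rw [zero_mul]; positivity
    · rw [← le_div_iff₀' hρ]
      exact Metric.diam_le_of_forall_dist_le (by positivity) fun k hk l hl =>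
        (le_div_iff₀' hρ).2 (h0 k hk l hl)

/-- If the iterates of the unit square are more and more homothetic to `K`, then some generalized
rotation set has the homothety type of `K`. -/
theorem exists_isGeneralizedRotationSet {F : Plane → Plane} (hF : Continuous F) {x₀ : Plane}
    (hx₀ : x₀ ∈ unitSquare) {K : Set Plane} (hK : IsCompact K) (hKn : K.Nontrivial)
    {n : ℕ → ℕ} {ρ δ : ℕ → ℝ} (hρ0 : ∀ i, 0 < ρ i) (hρ : Tendsto ρ atTop atTop)
    (hδ : Tendsto (fun i => δ i / ρ i) atTop (𝓝 0))
    (h : ∀ i, HomotheticWithin (δ i) (ρ i) (F^[n i] '' unitSquare) K) :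
    ∃ L, IsGeneralizedRotationSet F x₀ L ∧ SameHomothetyType K L := by
  have hd := Metric.diam_pos hKn hK.isBounded
  set d := Metric.diam K
  set D : ℕ → ℝ := fun i => Metric.diam (F^[n i] '' unitSquare) with hD
  have hD0 : ∀ i, 0 ≤ (D i)⁻¹ := fun i => inv_nonneg.2 Metric.diam_nonneg
  have hDρ : Tendsto (fun i => D i / ρ i) atTop (𝓝 d) := by
    rw [tendsto_iff_dist_tendsto_zero]
    refine squeeze_zero (fun _ => dist_nonneg) (fun i => ?_) (by simpa using hδ.const_mul 2)
    have h1 := (h i).abs_diam_sub_le (hρ0 i).le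
      (isCompact_unitSquare.image (hF.iterate _)).isBounded hK.isBounded hKn.nonempty
    have h2 : D i / ρ i - d = (D i - ρ i * d) / ρ i := by
      have := (hρ0 i).ne'
      field_simp
    rw [Real.dist_eq, h2, abs_div, abs_of_pos (hρ0 i), ← mul_div_assoc]
    have := hρ0 i
    gcongr
  have hDtop : Tendsto D atTop atTop := by
    refine (hDρ.pos_mul_atTop hd hρ).congr fun i => ?_
    have := (hρ0 i).ne'
    field_simp
  set r : ℕ → ℝ := fun i => (D i)⁻¹ * ρ i with hr
  have hr0 : ∀ i, 0 ≤ r i := fun i => mul_nonneg (hD0 i) (hρ0 i).le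
  have hrlim : Tendsto r atTop (𝓝 d⁻¹) :=
    (hDρ.inv₀ hd.ne').congr fun i => by rw [inv_div, div_eq_inv_mul]
  have hδD : Tendsto (fun i => (D i)⁻¹ * δ i) atTop (𝓝 0) := by
    have := hrlim.mul hδ
    rw [mul_zero] at this
    refine this.congr fun i => ?_
    have := (hρ0 i).ne'
    simp only [hr]
    field_simp
  choose v hv1 hv2 using h
  set b : ℕ → Plane := fun i => (D i)⁻¹ • (v i - F^[n i] x₀) with hb
  obtain ⟨M, hM⟩ := hK.isBounded.exists_norm_le
  have hM0 : 0 ≤ M := (norm_nonneg _).trans (hM _ hKn.nonempty.some_mem)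
  have hclose : ∀ i x k, dist (F^[n i] x) (ρ i • k + v i) ≤ δ i →
      dist ((D i)⁻¹ • (F^[n i] x - F^[n i] x₀)) (r i • k + b i) ≤ (D i)⁻¹ * δ i := by
    intro i x k hxk
    have h1 : r i • k + b i = (D i)⁻¹ • (ρ i • k + v i - F^[n i] x₀) := by
      simp only [hr, hb]
      module
    rw [h1, dist_smul₀, Real.norm_of_nonneg (hD0 i), dist_sub_right]
    exact mul_le_mul_of_nonneg_left hxk (hD0 i)
  have hbbd : ∀ᶠ i in atTop, b i ∈ Metric.closedBall (0 : Plane) (1 + (d⁻¹ + 1) * M) := by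
    filter_upwards [hrlim.eventually_le_const (lt_add_one _),
      hδD.eventually_le_const one_pos] with i hi1 hi2
    -- The renormalised image of the base point is `0`, which is thus close to `r i • K + b i`; this
    -- bounds the translation vectors `b i` and allows a convergent subsequence.
    obtain ⟨k, hk, hxk⟩ := hv1 i _ ⟨x₀, hx₀, rfl⟩
    have h1 := hclose i x₀ k hxk
    rw [sub_self, smul_zero, dist_zero_left] at h1
    rw [mem_closedBall_zero_iff]
    calc ‖b i‖ = ‖(r i • k + b i) - r i • k‖ := by rw [add_sub_cancel_left]
      _ ≤ ‖r i • k + b i‖ + ‖r i • k‖ := norm_sub_le _ _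
      _ ≤ 1 + (d⁻¹ + 1) * M := by
        rw [norm_smul, Real.norm_of_nonneg (hr0 i)]
        gcongr
        · exact h1.trans hi2
        · exact hM k hk
  obtain ⟨b', -, ψ, hψ, hblim⟩ := tendsto_subseq_of_frequently_bounded
    Metric.isBounded_closedBall hbbd.frequently
  have hψt := hψ.tendsto_atTop
  set e : ℕ → ℝ := fun i => (D (ψ i))⁻¹ * δ (ψ i) + (|r (ψ i) - d⁻¹| * M + dist (b (ψ i)) b')
    with he
  have helim : Tendsto e atTop (𝓝 0) := by
    have h1 : Tendsto (fun i => |r (ψ i) - d⁻¹| * M) atTop (𝓝 (|d⁻¹ - d⁻¹| * M)) :=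
      (((hrlim.comp hψt).sub_const d⁻¹).abs).mul_const M
    have h2 := (hδD.comp hψt).add (h1.add (tendsto_iff_dist_tendsto_zero.1 hblim))
    simpa using h2
  have hfin : ∀ i x, ∀ k ∈ K, dist (F^[n (ψ i)] x) (ρ (ψ i) • k + v (ψ i)) ≤ δ (ψ i) →
      edist ((D (ψ i))⁻¹ • (F^[n (ψ i)] x - F^[n (ψ i)] x₀)) (d⁻¹ • k + b') ≤
        ENNReal.ofReal (e i) := by
    intro i x k hk hxk
    rw [edist_dist]
    refine ENNReal.ofReal_le_ofReal ((dist_triangle _ _ _).trans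
      (add_le_add (hclose _ x k hxk) ?_))
    refine (dist_add_add_le _ _ _ _).trans (add_le_add ?_ le_rfl)
    rw [dist_eq_norm, ← sub_smul, norm_smul, Real.norm_eq_abs]
    gcongr
    exact hM k hk
  refine ⟨(fun x => d⁻¹ • x + b') '' K, ⟨hK.image (by fun_prop), hKn.nonempty.image _, n ∘ ψ,
    hDtop.comp hψt, ?_⟩, d⁻¹, inv_pos.2 hd, b', rfl⟩
  have hofReal : Tendsto (fun i => ENNReal.ofReal (e i)) atTop (𝓝 0) := by
    simpa using ENNReal.tendsto_ofReal helim
  refine tendsto_of_tendsto_of_tendsto_of_le_of_le tendsto_const_nhds hofReal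
    (fun _ => zero_le) fun i => ?_
  refine Metric.hausdorffEDist_le_of_mem_edist ?_ ?_
  · rintro _ ⟨x, hx, rfl⟩
    obtain ⟨k, hk, hxk⟩ := hv1 (ψ i) _ ⟨x, hx, rfl⟩
    exact ⟨_, ⟨k, hk, rfl⟩, hfin i x k hk hxk⟩
  · rintro _ ⟨k, hk, rfl⟩
    obtain ⟨_, ⟨x, hx, rfl⟩, hxk⟩ := hv2 (ψ i) k hk
    refine ⟨_, ⟨x, hx, rfl⟩, ?_⟩
    rw [edist_comm]
    exact hfin i x k hk hxk

/-- The lift provided by `shapeSet` may vary with `i`. Its iterates differ from those of `F` by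
integer vectors, which do not affect approximate homothety. -/
theorem exists_isGeneralizedRotationSet_of_mem_shapeSet {f : TorusDiffeo} {K : Set Plane}
    (hK : IsCompact K) (hKn : K.Nontrivial) (hf : ∀ i : ℕ, f ∈ shapeSet K ((i : ℝ) + 1)⁻¹)
    {F : Plane → Plane} (hF : IsLift F f) {x₀ : Plane} (hx₀ : x₀ ∈ unitSquare) :
    ∃ L, IsGeneralizedRotationSet F x₀ L ∧ SameHomothetyType K L := by
  choose G hG n ρ δ hρ hδ hh using hf
  simp only [inv_inv] at hρ
  have hρ0 : ∀ i, 0 < ρ i := fun i => lt_trans (by positivity) (hρ i)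
  have hδ0 : ∀ i, 0 ≤ δ i := by
    intro i
    obtain ⟨v, -, hv⟩ := hh i
    obtain ⟨k, hk⟩ := hKn.nonempty
    obtain ⟨x, -, hx⟩ := hv k hk
    exact dist_nonneg.trans hx
  refine exists_isGeneralizedRotationSet hF.1 hx₀ hK hKn (n := n) (δ := δ) hρ0
    (tendsto_atTop_mono (fun i => (lt_add_one _).le.trans (hρ i).le) tendsto_natCast_atTop_atTop)
    (squeeze_zero (fun i => div_nonneg (hδ0 i) (hρ0 i).le)
      (fun i => (div_le_iff₀ (hρ0 i)).2 (hδ i).le) ?_) fun i => ?_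
  · simpa using tendsto_one_div_add_atTop_nhds_zero_nat (𝕜 := ℝ)
  · obtain ⟨c, hc⟩ := (hF.iterate (n i)).eq_add_intVec ((hG i).iterate (n i))
    have := (hh i).add_image (intVec c)
    rw [Set.image_image] at this
    simpa only [← hc] using this

/-- Passes from the countable dense family to arbitrary shapes: half of the tolerance is spent on
replacing `K'` by `K`. -/
theorem mem_shapeSet_of_close {f : TorusDiffeo} {K K' : Set Plane} {η : ℝ} (hη : 0 < η)
    (hf : f ∈ shapeSet K' (η / 2)) (h1 : ∀ k ∈ K', ∃ k' ∈ K, dist k k' ≤ η / 2)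
    (h2 : ∀ k ∈ K, ∃ k' ∈ K', dist k k' ≤ η / 2) : f ∈ shapeSet K η := by
  obtain ⟨F, hF, n, ρ, δ, hρ, hδ, hh⟩ := hf
  have hρ' : η⁻¹ < ρ := (inv_anti₀ (half_pos hη) (half_le_self hη.le)).trans_lt hρ
  have hρ0 : 0 < ρ := (inv_pos.2 hη).trans hρ'
  exact ⟨F, hF, n, ρ, _, hρ', by linarith, hh.of_close hρ0.le h1 h2⟩

/-- There is a countable family of point-symmetric compact convex sets, dense with respect to the
Hausdorff distance. -/
theorem exists_countable_dense_symmetric : ∃ S : Set (TopologicalSpace.NonemptyCompacts Plane),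
    S.Countable ∧ (∀ K ∈ S, Convex ℝ (K : Set Plane) ∧ IsPointSymmetric (K : Set Plane)) ∧
    ∀ K : Set Plane, IsCompact K → Convex ℝ K → K.Nonempty → IsPointSymmetric K → ∀ ε > 0,
      ∃ K' ∈ S, (∀ k ∈ (K' : Set Plane), ∃ k' ∈ K, dist k k' ≤ ε) ∧
        ∀ k ∈ K, ∃ k' ∈ (K' : Set Plane), dist k k' ≤ ε := by
  let T : Set (TopologicalSpace.NonemptyCompacts Plane) :=
    {K | Convex ℝ (K : Set Plane) ∧ IsPointSymmetric (K : Set Plane)}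
  -- A subspace of a separable metric space is separable, so the dense family can be taken inside
  -- the convex symmetric sets.
  obtain ⟨D, hDc, hDd⟩ := TopologicalSpace.exists_countable_dense T
  refine ⟨Subtype.val '' D, hDc.image _, ?_, fun K hK hKc hne hs ε hε => ?_⟩
  · rintro _ ⟨K, -, rfl⟩
    exact K.2
  · let K₀ : T := ⟨⟨⟨K, hK⟩, hne⟩, hKc, hs⟩
    obtain ⟨K', hK', hdist⟩ := hDd.exists_mem_open (Metric.isOpen_eball (x := K₀)
      (ε := ENNReal.ofReal ε)) ⟨K₀, Metric.mem_eball_self (by simpa using hε)⟩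
    have hdist' : Metric.hausdorffEDist (K'.1 : Set Plane) K < ENNReal.ofReal ε := hdist
    refine ⟨_, ⟨K', hK', rfl⟩, fun k hk => ?_, fun k hk => ?_⟩
    · obtain ⟨y, hy, hky⟩ := Metric.exists_edist_lt_of_hausdorffEDist_lt hk hdist'
      exact ⟨y, hy, (edist_lt_ofReal.1 hky).le⟩
    · rw [Metric.hausdorffEDist_comm] at hdist'
      obtain ⟨y, hy, hky⟩ := Metric.exists_edist_lt_of_hausdorffEDist_lt hk hdist'
      exact ⟨y, hy, (edist_lt_ofReal.1 hky).le⟩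

/-- In the closure of a class of conjugates of rotations that is stable under area-preserving
changes of the conjugating diffeomorphism, the generic element admits generalized rotation sets of
all point-symmetric convex types. -/
theorem eventually_residual_admitsAllSymmetricTypes {H : Set TorusDiffeo}
    (hH : ∀ h ∈ H, ∀ φ : TorusDiffeo, MeasurePreserving φ volume volume → h.comp φ ∈ H) :
    ∀ᶠ f : closure (conjugatesOfRotations H) in residual (closure (conjugatesOfRotations H)),
      AdmitsAllSymmetricTypes f := by
  obtain ⟨S, hSc, hS, hSd⟩ := exists_countable_dense_symmetric
  have hdense : ∀ K ∈ S, ∀ i : ℕ,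
      ∀ᶠ f : closure (conjugatesOfRotations H) in residual (closure (conjugatesOfRotations H)),
        (f : TorusDiffeo) ∈ shapeSet (K : Set Plane) ((((i : ℝ) + 1)⁻¹) / 2) := by
    intro K hK i
    have hη : 0 < (((i : ℝ) + 1)⁻¹) / 2 := by positivity
    refine residual_of_dense_open ((isOpen_shapeSet _ _).preimage continuous_subtype_val)
      (Subtype.dense_iff.2 ?_)
    -- Density need only be checked at genuine conjugates of rotations, and their perturbations are
    -- again such conjugates by the stability of `H`.
    refine closure_minimal ?_ isClosed_closure
    rintro f ⟨h, hh, θ, hf⟩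
    obtain ⟨θ, rfl⟩ := torusProj_surjective θ
    refine mem_closure_iff.2 fun U hU hfU => ?_
    obtain ⟨k, ε, hε, hball⟩ := hU f hfU
    obtain ⟨φ, hφ, β, hmem, hclose⟩ := exists_conjRotation_mem_shapeSet h θ K.isCompact (hS K hK).1
      K.nonempty (hS K hK).2 hη k hε
    exact ⟨_, hball _ (hclose f hf), ⟨_, subset_closure
      ⟨h.comp φ, hH h hh φ hφ, torusProj β, fun x => rfl⟩⟩, hmem, rfl⟩
  have hall : ∀ᶠ f : closure (conjugatesOfRotations H) in
      residual (closure (conjugatesOfRotations H)), ∀ K ∈ S, ∀ i : ℕ,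
        (f : TorusDiffeo) ∈ shapeSet (K : Set Plane) ((((i : ℝ) + 1)⁻¹) / 2) :=
    (eventually_countable_ball hSc).2 fun K hK => eventually_countable_forall.2 (hdense K hK)
  filter_upwards [hall] with f hf x₀ hx₀ F hF K hK hKc hKn hs
  refine exists_isGeneralizedRotationSet_of_mem_shapeSet hK hKn (fun i => ?_) hF hx₀
  obtain ⟨K', hK', h1, h2⟩ := hSd K hK hKc hKn.nonempty hs ((((i : ℝ) + 1)⁻¹) / 2) (by positivity)
  exact mem_shapeSet_of_close (by positivity) (hf K' hK' i) h1 h2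

end

theorem theoremB :
    (∀ᶠ f : anosovKatokClass in residual anosovKatokClass,
      AdmitsAllSymmetricTypes f) ∧
    (∀ᶠ f : areaPreservingAnosovKatokClass in residual areaPreservingAnosovKatokClass,
      AdmitsAllSymmetricTypes f) :=
  ⟨eventually_residual_admitsAllSymmetricTypes fun _ _ _ _ => Set.mem_univ _,
    eventually_residual_admitsAllSymmetricTypes fun _ hh _ hφ => hh.comp hφ⟩
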